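/- **Definitions.** Let $S$ be a finite set and let $\mathcal E^Q=\{(E_1,p_1),\dots,(E_m,p_m)\}$, $m\ge 1$, be a *quantitative evidence set*: the $E_i$ are distinct nonempty proper subsets of $S$ and $p_i\in(0,1)$. Put $\mathcal E=\{E_1,\dots,E_m\}$; for $\mathbf E\subseteq\mathcal E$ let $\tau_{\mathbf E}$ be the topology generated by $\mathbf E$. A *frame of justification* is a set $\mathcal J\subseteq\tau_{\mathcal E}$. A *set of evidence allocation functions* is a set $\mathfrak F$ of functions $2^{\mathcal E}\to\tau_{\mathcal E}$ such that for all $f,g\in\mathfrak F$: (1) $f(\emptyset)=S$; (2) for every nonempty $\mathbf E\subseteq\mathcal E$, either $f(\mathbf E)=\emptyset$, or $f(\mathbf E)\in\tau_{\mathbf E}$ and $f(\mathbf E)$ is dense in $\bigcup\mathbf E$ with respect to $\tau_{\mathbf E}$ (that is, $f(\mathbf E)\subseteq\bigcup\mathbf E$ and $f(\mathbf E)$ meets every nonempty $T\in\tau_{\mathbf E}$ with $T\subseteq\bigcup\mathbf E$); (3) for every $\mathbf E\subseteq\mathcal E$, $f(\mathbf E)\subseteq g(\mathbf E)$ or $g(\mathbf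 E)\subseteq f(\mathbf E)$. An *evidence allocation function* is a member of such a set. Put $$\delta(\mathbf E)=\prod_{E_i\in\mathbf E}p_i\prod_{E_i\notin\mathbf E}(1-p_i),\qquad \delta_\tau(f,T)=\begin{cases}\sum_{\mathbf E\subseteq\mathcal E:\,f(\mathbf E)=T}\delta(\mathbf E)&\text{if }T\in\tau_{\mathcal E},\\0&\text{otherwise,}\end{cases}$$ $$\delta_{\mathcal J}(f,A)=\begin{cases}\dfrac{\delta_\tau(f,A)}{\sum_{T\in\mathcal J}\delta_\tau(f,T)}&\text{if }A\in\mathcal J,\\0&\text{otherwise,}\end{cases}\qquad \mathrm{Bel}_{\mathcal J}(f,P)=\sum_{A\subseteq P}\delta_{\mathcal J}(f,A).$$ **The problem Degree of Belief.** An instance consists of $S=\{0,\dots,n-1\}$, a quantitative evidence set with rational $p_i$, a frame of justification $\mathcal J$ and an evidence allocation function $f$ such that $\sum_{T\in\mathcal J}\delta_\tau(f,T)\ne 0$ (so that the degrees of belief are defined; this holds automatically when $S\in\mathcal J$), and $P\subseteq S$. The task is to compute $\mathrm{Bel}_{\mathcal J}(f,P)$. In the input word, $n$ is written in unary, subsets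 of $S$ are written as bit vectors, the $p_i$ by the binary expansions of numerator and denominator, and $\mathcal J$ and $f$ are given by binary words $s_{\mathcal J}$ and $s_f$, their descriptions in fixed formats. A format for frames of justification is interpreted by a function $\chi:\{0,1\}^*\to\{0,1\}$ with $\chi(s_{\mathcal J},(S,\mathcal E^Q),T)=1\iff T\in\mathcal J$ for all $T\subseteq S$, and a format for allocation functions by a function $\varphi:\{0,1\}^*\to\{0,1\}^*$ with $\varphi(s_f,(S,\mathcal E^Q),\mathbf E)=f(\mathbf E)$ for all $\mathbf E\subseteq\mathcal E$, where tuples and sets are suitably coded as binary words. A function $g:\{0,1\}^*\to\mathbb N$ is in $\#\mathrm P$ if there are a polynomial $q$ and a polynomial-time decidable relation $R$ with $g(x)=|\{y\in\{0,1\}^{q(|x|)}: R(x,y)\}|$ for all $x$. **Proposition.** Degree of Belief is in $\#\mathrm P$ whenever the characteristic function of the frame of justification is polynomial-time decidable and the evidence allocation function is polynomial-time computable, both being given as part of the input. Precisely: for all formats whose interpreters $\chi$ and $\varphi$ are computable in polynomial time there are functions $N,D:\{0,1\}^*\to\mathbb N$ in $\#\mathrm P$ such that, for every instance with input word $x$,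 $D(x)\neq 0$ and $\mathrm{Bel}_{\mathcal J}(f,P)=N(x)/D(x)$. -/

import Mathlib

noncomputable section

namespace MultiLayerBelief

/-! ### Polynomial time and the class `#P` -/

/-- `D` is decided by a Turing machine in time polynomial in the length of its input. -/
def PolyTimeDecidable (D : List Bool → Bool) : Prop :=
  Nonempty (Turing.TM2ComputableInPolyTime (id : List Bool → List Bool)
    Computability.encodeBool D)

/-- `F` is computed by a Turing machine in time polynomial in the length of its input. -/
def PolyTimeComputable (F : List Bool → List Bool) : Prop :=
  Nonempty (Turing.TM2ComputableInPolyTime (id : List Bool → List Bool)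
    (id : List Bool → List Bool) F)

/-- Self-delimiting code of a word: every letter `b` becomes `1b`, and `0` marks the end. -/
def encodeWord (w : List Bool) : List Bool :=
  w.flatMap (fun b => [true, b]) ++ [false]

/-- A finite sequence of words, coded as one word. -/
def encodeTuple (ws : List (List Bool)) : List Bool :=
  ws.flatMap encodeWord

/-- The counting class `#P`: `g x` is the number of words `y` of length exactly `q (|x|)`, for a
polynomial `q`, such that the pair `(x, y)` is accepted by a polynomial-time machine. -/
def InSharpP (g : List Bool → ℕ) : Prop :=
  ∃ (q : Polynomial ℕ) (R : List Bool → Bool), PolyTimeDecidable R ∧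
    ∀ x : List Bool, g x =
      (Finset.univ.filter fun y : List.Vector Bool (q.eval x.length) =>
        R (encodeTuple [x, y.toList]) = true).card

/-- A rational-valued problem `value`, on instances written as words by `encode`, is in `#P` with
fractions specified by pairs (numerator, denominator): both components are `#P` functions. Nothing
is demanded on words that encode no instance. -/
def FractionInSharpP {α : Type} (encode : α → List Bool) (value : α → ℚ) : Prop :=
  ∃ num den : List Bool → ℕ, InSharpP num ∧ InSharpP den ∧
    ∀ a : α, den (encode a) ≠ 0 ∧
      value a = (num (encode a) : ℚ) / (den (encode a) : ℚ)

/-! ### The multi-layer belief model -/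

section Model

variable {S : Type} [Fintype S] [DecidableEq S]

/-- The topology on `S` generated by a family of subsets of `S`. -/
abbrev evidentialTopology (Ev : Finset (Finset S)) : TopologicalSpace S :=
  TopologicalSpace.generateFrom {U : Set S | ∃ E ∈ Ev, U = (E : Set S)}

/-- `T` is an element of the topology generated by `Ev`. -/
def InTopology (Ev : Finset (Finset S)) (T : Finset S) : Prop :=
  @IsOpen S (evidentialTopology Ev) (T : Set S)

/-- A quantitative evidence set `{(E₁, p₁), …, (Eₘ, pₘ)}`, `m ≥ 1`: the `Eᵢ` are distinct, nonempty
and different from `S`, and `0 < pᵢ < 1`. (In particular `S` is nonempty.) -/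
structure IsQuantitativeEvidence (EQ : Finset (Finset S × ℚ)) : Prop where
  nonempty : EQ.Nonempty
  distinct : ∀ x ∈ EQ, ∀ y ∈ EQ, x.1 = y.1 → x = y
  evidence_nonempty : ∀ x ∈ EQ, x.1.Nonempty
  evidence_ne_univ : ∀ x ∈ EQ, x.1 ≠ Finset.univ
  degree_pos : ∀ x ∈ EQ, 0 < x.2
  degree_lt_one : ∀ x ∈ EQ, x.2 < 1

/-- The set `{E₁, …, Eₘ}` of basic pieces of evidence. -/
def basicEvidence (EQ : Finset (Finset S × ℚ)) : Finset (Finset S) :=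
  EQ.image Prod.fst

/-- A frame of justification is a subset of the evidential topology. -/
def IsFrameOfJustification (Ev : Finset (Finset S)) (J : Finset (Finset S)) : Prop :=
  ∀ T ∈ J, InTopology Ev T

/-- `D` is dense in `⋃ B` with respect to the topology generated by `B`. -/
def IsDenseInUnion (B : Finset (Finset S)) (D : Finset S) : Prop :=
  D ⊆ B.biUnion id ∧
    ∀ T : Finset S, InTopology B T → T ⊆ B.biUnion id → T.Nonempty → (D ∩ T).Nonempty

/-- Sets of evidence allocation functions. Such a function has domain the power set of `Ev`; only its
values on subsets of `Ev` matter. -/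
structure IsEvidenceAllocationSet (Ev : Finset (Finset S))
    (F : Set (Finset (Finset S) → Finset S)) : Prop where
  mem_topology : ∀ f ∈ F, ∀ B ⊆ Ev, InTopology Ev (f B)
  map_empty : ∀ f ∈ F, f ∅ = Finset.univ
  map_nonempty : ∀ f ∈ F, ∀ B ⊆ Ev, B.Nonempty →
    (InTopology B (f B) ∧ IsDenseInUnion B (f B)) ∨ f B = ∅
  comparable : ∀ f ∈ F, ∀ g ∈ F, ∀ B ⊆ Ev, f B ⊆ g B ∨ g B ⊆ f B

/-- An evidence allocation function is a member of some set of evidence allocation functions. -/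
def IsEvidenceAllocation (Ev : Finset (Finset S)) (f : Finset (Finset S) → Finset S) : Prop :=
  ∃ F : Set (Finset (Finset S) → Finset S), IsEvidenceAllocationSet Ev F ∧ f ∈ F

/-- `δ(B) = ∏_{Eᵢ ∈ B} pᵢ · ∏_{Eᵢ ∉ B} (1 - pᵢ)`. -/
def delta (EQ : Finset (Finset S × ℚ)) (B : Finset (Finset S)) : ℚ :=
  (∏ x ∈ EQ with x.1 ∈ B, x.2) * ∏ x ∈ EQ with x.1 ∉ B, (1 - x.2)

open Classical in
/-- `δ_τ(f, T)`: the sum of `δ(B)` over the `B` allocated to `T`, if `T` is in the topology. -/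
def deltaTop (EQ : Finset (Finset S × ℚ)) (f : Finset (Finset S) → Finset S) (T : Finset S) : ℚ :=
  if InTopology (basicEvidence EQ) T then
    ∑ B ∈ (basicEvidence EQ).powerset with f B = T, delta EQ B
  else 0

/-- The normalization factor `∑_{T ∈ J} δ_τ(f, T)`. -/
def normalization (EQ : Finset (Finset S × ℚ)) (J : Finset (Finset S))
    (f : Finset (Finset S) → Finset S) : ℚ :=
  ∑ T ∈ J, deltaTop EQ f T

/-- `δ_J(f, A)`. -/
def deltaJ (EQ : Finset (Finset S × ℚ)) (J : Finset (Finset S))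
    (f : Finset (Finset S) → Finset S) (A : Finset S) : ℚ :=
  if A ∈ J then deltaTop EQ f A / normalization EQ J f else 0

/-- The degree of belief `Bel_J(f, P) = ∑_{A ⊆ P} δ_J(f, A)`. -/
def Bel (EQ : Finset (Finset S × ℚ)) (J : Finset (Finset S))
    (f : Finset (Finset S) → Finset S) (P : Finset S) : ℚ :=
  ∑ A ∈ P.powerset, deltaJ EQ J f A

end Model

/-! ### The computational problem -/

/-- The characteristic bit vector of a set of states, `S = {0, …, n - 1}`. -/
def encodeStates {n : ℕ} (T : Finset (Fin n)) : List Bool :=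
  List.ofFn fun i => decide (i ∈ T)

/-- The characteristic bit vector of `B ⊆ {E₁, …, Eₘ}`, in the order of the list. -/
def encodeEvidenceSet {n : ℕ} (ev : List (Finset (Fin n) × ℚ)) (B : Finset (Finset (Fin n))) :
    List Bool :=
  ev.map fun x => decide (x.1 ∈ B)

/-- The code of `(S, {(E₁, p₁), …, (Eₘ, pₘ)})`: `n` in unary, and then, for each `i`, the bit vector
of `Eᵢ` and the binary expansions of the numerator and the denominator of `pᵢ`. -/
def encodeEvidenceFrame (n : ℕ) (ev : List (Finset (Fin n) × ℚ)) : List Bool :=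
  encodeTuple (List.replicate n true ::
    ev.flatMap fun x => [encodeStates x.1, Nat.bits x.2.num.toNat, Nat.bits x.2.den])

/-- An instance of the problem "Degree of Belief". The frame of justification `J` and the evidence
allocation function `f` are given by descriptions `specJ` and `specF`, which are words in formats
whose interpreters are `evalJ` and `evalF`: `evalJ` decides from `specJ`, the evidence frame and
`T ⊆ S` whether `T ∈ J`, and `evalF` computes `f B` from `specF`, the evidence frame and `B`. -/
structure Instance (evalJ : List Bool → Bool) (evalF : List Bool → List Bool) where
  /-- the number of states -/
  n : ℕ
  /-- the list `(E₁, p₁), …, (Eₘ, pₘ)` -/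
  evidence : List (Finset (Fin n) × ℚ)
  /-- no entry of the list is repeated -/
  evidence_nodup : evidence.Nodup
  isEvidence : IsQuantitativeEvidence evidence.toFinset
  /-- the frame of justification -/
  J : Finset (Finset (Fin n))
  isFrame : IsFrameOfJustification (basicEvidence evidence.toFinset) J
  /-- the evidence allocation function -/
  f : Finset (Finset (Fin n)) → Finset (Fin n)
  isAllocation : IsEvidenceAllocation (basicEvidence evidence.toFinset) f
  /-- the degrees of belief are well defined; this is automatic if `S ∈ J` -/
  normalization_ne_zero : normalization evidence.toFinset J f ≠ 0
  /-- the description of `J` -/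
  specJ : List Bool
  specJ_spec : ∀ T : Finset (Fin n),
    evalJ (encodeTuple [specJ, encodeEvidenceFrame n evidence, encodeStates T]) = true ↔ T ∈ J
  /-- the description of `f` -/
  specF : List Bool
  specF_spec : ∀ B ⊆ basicEvidence evidence.toFinset,
    evalF (encodeTuple [specF, encodeEvidenceFrame n evidence, encodeEvidenceSet evidence B]) =
      encodeStates (f B)
  /-- the proposition -/
  P : Finset (Fin n)

namespace Instance

variable {evalJ : List Bool → Bool} {evalF : List Bool → List Bool}

/-- The input word: the evidence frame, the descriptions of `J` and `f`, and `P`. -/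
def encode (I : Instance evalJ evalF) : List Bool :=
  encodeTuple [encodeEvidenceFrame I.n I.evidence, I.specJ, I.specF, encodeStates I.P]

/-- The required output `Bel_J(f, P)`. -/
def degreeOfBelief (I : Instance evalJ evalF) : ℚ :=
  Bel I.evidence.toFinset I.J I.f I.P

end Instance

end MultiLayerBelief

end

/-! The degree of belief is a quotient of two sums of `delta` over sets of evidence: over the `B`
with `f B ∈ J` and `f B ⊆ P`, and over the `B` with `f B ∈ J` (`Bel_eq`). Each sum, times one common
factor, counts accepted certificates. Let pᵢ = aᵢ/dᵢ in lowest terms. A certificate is cut into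
blocks, the i-th as long as the binary expansion of dᵢ. A block is valid if its value is below dᵢ,
and it puts Eᵢ into the guessed set `B` if its value is below aᵢ. So aᵢ = dᵢpᵢ valid blocks select
Eᵢ and dᵢ - aᵢ = dᵢ(1 - pᵢ) reject it, and exactly (∏ dᵢ) · δ(B) valid sequences of blocks produce
`B`. Certificates have the length of the input, which is enough because the digits of all dᵢ occur
in the input; the q digits left over multiply every count by 2^q. The factor 2^q · ∏ dᵢ is the same
for numerator and denominator and cancels (`exists_countAccepted_eq`). The counting is done by
`countWords_digits`, `countWords_guess` and `weight_eq`.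

The relation has to be decided by an actual Turing machine in polynomial time. The verifier is
assembled from program fragments over registers that are stacks of bits, together with the two given
machines for `evalF` and `evalJ`, which run on stacks of their own. `Runs` is a Hoare-style
specification with a time bound; it composes along `seq`, `pop`, `loop` and `call`. Simulation of an
embedded machine is `reachIn_embedCfg`; the verifier is specified by `runs_verifier`, and
`accept_eq` translates its answer on codes of instances into the combinatorial condition that is
counted. -/

noncomputable section

open Turing Function

namespace StackProgram

/-! ### Bounded reachability -/

section Reach

variable {K : Type} [DecidableEq K] {Γ : K → Type} {Λ σ : Type}

/-- `c'` is reached from `c` in at most `t` steps. -/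
def ReachIn (m : Λ → TM2.Stmt Γ Λ σ) (c c' : TM2.Cfg Γ Λ σ) (t : ℕ) : Prop :=
  ∃ n ≤ t, (flip bind (TM2.step m))^[n] (some c) = some c'

theorem ReachIn.refl (m : Λ → TM2.Stmt Γ Λ σ) (c : TM2.Cfg Γ Λ σ) : ReachIn m c c 0 :=
  ⟨0, le_rfl, rfl⟩

theorem ReachIn.mono {m : Λ → TM2.Stmt Γ Λ σ} {c c' : TM2.Cfg Γ Λ σ} {t t' : ℕ}
    (h : ReachIn m c c' t) (htt : t ≤ t') : ReachIn m c c' t' :=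
  let ⟨n, hn, e⟩ := h
  ⟨n, hn.trans htt, e⟩

theorem ReachIn.trans {m : Λ → TM2.Stmt Γ Λ σ} {c c' c'' : TM2.Cfg Γ Λ σ} {t t' : ℕ}
    (h : ReachIn m c c' t) (h' : ReachIn m c' c'' t') : ReachIn m c c'' (t + t') := by
  obtain ⟨n, hn, e⟩ := h
  obtain ⟨n', hn', e'⟩ := h'
  exact ⟨n' + n, by omega, by rw [iterate_add_apply, e, e']⟩

theorem ReachIn.step {m : Λ → TM2.Stmt Γ Λ σ} {l : Λ} {v : σ} {S : ∀ k, List (Γ k)}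
    {c : TM2.Cfg Γ Λ σ} (h : TM2.stepAux (m l) v S = c) : ReachIn m ⟨some l, v, S⟩ c 1 :=
  ⟨1, le_rfl, by simp [flip, TM2.step, h]⟩

theorem ReachIn.cons {m : Λ → TM2.Stmt Γ Λ σ} {l : Λ} {q : TM2.Stmt Γ Λ σ} {v : σ}
    {S : ∀ k, List (Γ k)} {c c' : TM2.Cfg Γ Λ σ} {t : ℕ} (hl : m l = q)
    (h : TM2.stepAux q v S = c) (h' : ReachIn m c c' t) : ReachIn m ⟨some l, v, S⟩ c' (t + 1) :=
  ((ReachIn.step (hl ▸ h)).trans h').mono (by omega)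

end Reach

/-! ### Simulation of an embedded machine -/

section Embed

variable {K K₀ : Type} [DecidableEq K] [DecidableEq K₀] {Γ : K → Type} {Λ₀ L σ σ₀ : Type}

/-- The statement `q` of a machine whose stacks are the stacks `ι k` of a larger machine, whose
state is a component of the state of that machine, and which jumps to `exit` instead of halting. -/
def embedStmt (ι : K₀ → K) (get : σ → σ₀) (set : σ₀ → σ → σ) (emb : Λ₀ → L) (exit : L) :
    TM2.Stmt (fun k => Γ (ι k)) Λ₀ σ₀ → TM2.Stmt Γ L σ
  | .push k f q => .push (ι k) (fun v => f (get v)) (embedStmt ι get set emb exit q)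
  | .peek k f q => .peek (ι k) (fun v o => set (f (get v) o) v) (embedStmt ι get set emb exit q)
  | .pop k f q => .pop (ι k) (fun v o => set (f (get v) o) v) (embedStmt ι get set emb exit q)
  | .load f q => .load (fun v => set (f (get v)) v) (embedStmt ι get set emb exit q)
  | .branch f q q' => .branch (fun v => f (get v)) (embedStmt ι get set emb exit q)
      (embedStmt ι get set emb exit q')
  | .goto f => .goto fun v => emb (f (get v))
  | .halt => .goto fun _ => exit

/-- The configuration of the larger machine which corresponds to one of the embedded machine. -/
def embedCfg (ι : K₀ → K) (set : σ₀ → σ → σ) (emb : Λ₀ → L) (exit : L) (v : σ)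
    (ov : (∀ k, List (Γ (ι k))) → ∀ k, List (Γ k))
    (c : TM2.Cfg (fun k => Γ (ι k)) Λ₀ σ₀) : TM2.Cfg Γ L σ :=
  ⟨some (c.l.elim exit emb), set c.var v, ov c.stk⟩

variable {ι : K₀ → K} {get : σ → σ₀} {set : σ₀ → σ → σ} {emb : Λ₀ → L} {exit : L}
  {ov : (∀ k, List (Γ (ι k))) → ∀ k, List (Γ k)}

/-- Every instruction touches only the stacks `ι k` and the component of the state reached by `get`
and `set`, so the rest of the memory, carried by `v` and `ov`, is inert. A halt becomes a jump to
`exit`, in agreement with the `Option.elim` in `embedCfg`. -/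
theorem stepAux_embedStmt (hget : ∀ a v, get (set a v) = a)
    (hset : ∀ a b v, set a (set b v) = set a v)
    (hov : ∀ S k, ov S (ι k) = S k)
    (hup : ∀ S k x, update (ov S) (ι k) x = ov (update S k x)) (v : σ)
    (q : TM2.Stmt (fun k => Γ (ι k)) Λ₀ σ₀) (a : σ₀) (S : ∀ k, List (Γ (ι k))) :
    TM2.stepAux (embedStmt ι get set emb exit q) (set a v) (ov S) =
      embedCfg ι set emb exit v ov (TM2.stepAux q a S) := by
  induction q generalizing a S with
  | push k f q ih => simp only [embedStmt, TM2.stepAux, hget, hov, hup, ih]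
  | peek k f q ih => simp only [embedStmt, TM2.stepAux, hget, hov, hset, ih]
  | pop k f q ih => simp only [embedStmt, TM2.stepAux, hget, hov, hset, hup, ih]
  | load f q ih => simp only [embedStmt, TM2.stepAux, hget, hset, ih]
  | branch f q q' ih ih' =>
    simp only [embedStmt, TM2.stepAux, hget, ih, ih']
    cases f a <;> rfl
  | goto f => simp only [embedStmt, TM2.stepAux, hget, embedCfg, Option.elim]
  | halt => simp only [embedStmt, TM2.stepAux, embedCfg, Option.elim]

/-- Excludes runs that continue after the machine has halted. -/
theorem flip_bind_iterate_none {C : Type} (f : C → Option C) (n : ℕ) :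
    (flip bind f)^[n] none = none := by
  induction n with
  | zero => rfl
  | succ n ih => rw [iterate_succ_apply]; exact ih

theorem reachIn_embedCfg (hget : ∀ a v, get (set a v) = a)
    (hset : ∀ a b v, set a (set b v) = set a v)
    (hov : ∀ S k, ov S (ι k) = S k)
    (hup : ∀ S k x, update (ov S) (ι k) x = ov (update S k x)) (v : σ)
    (m₀ : Λ₀ → TM2.Stmt (fun k => Γ (ι k)) Λ₀ σ₀) (m : L → TM2.Stmt Γ L σ)
    (hm : ∀ l, m (emb l) = embedStmt ι get set emb exit (m₀ l)) (n : ℕ)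
    (c c' : TM2.Cfg (fun k => Γ (ι k)) Λ₀ σ₀)
    (h : (flip bind (TM2.step m₀))^[n] (some c) = some c') :
    ReachIn m (embedCfg ι set emb exit v ov c) (embedCfg ι set emb exit v ov c') n := by
  induction n generalizing c with
  | zero => cases h; exact ReachIn.refl _ _
  | succ n ih =>
    rw [iterate_succ_apply] at h
    obtain ⟨_ | l, a, S⟩ := c
    · have : flip bind (TM2.step m₀) (some (⟨none, a, S⟩ : TM2.Cfg _ Λ₀ σ₀)) = none := rfl
      rw [this, flip_bind_iterate_none] at h
      cases h
    · have h1 : flip bind (TM2.step m₀) (some (⟨some l, a, S⟩ : TM2.Cfg _ Λ₀ σ₀)) =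
        some (TM2.stepAux (m₀ l) a S) := rfl
      rw [h1] at h
      refine ((ReachIn.step ?_).trans (ih _ h)).mono (by omega)
      rw [Option.elim, hm]
      exact stepAux_embedStmt hget hset hov hup v _ _ _

end Embed

/-! ### Growth of the stacks -/

section Growth

variable {K : Type} [DecidableEq K] {Γ : K → Type} {Λ σ : Type}

/-- The number of push instructions in a statement. -/
def pushCount : TM2.Stmt Γ Λ σ → ℕ
  | .push _ _ q => pushCount q + 1
  | .peek _ _ q => pushCount q
  | .pop _ _ q => pushCount q
  | .load _ q => pushCount q
  | .branch _ q q' => pushCount q + pushCount q'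
  | .goto _ => 0
  | .halt => 0

theorem length_stk_stepAux_le (q : TM2.Stmt Γ Λ σ) (v : σ) (S : ∀ k, List (Γ k)) (k : K) :
    ((TM2.stepAux q v S).stk k).length ≤ (S k).length + pushCount q := by
  induction q generalizing v S with
  | push k' f q ih =>
    refine (ih _ _).trans ?_
    by_cases h : k = k'
    · subst h; simp only [update_self, List.length_cons, pushCount]; omega
    · simp only [update_of_ne h, pushCount]; omega
  | peek k' f q ih => exact ih _ _
  | pop k' f q ih =>
    refine (ih _ _).trans ?_
    by_cases h : k = k'
    · subst h; simp [pushCount]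
    · simp [h, pushCount]
  | load f q ih => exact ih _ _
  | branch f q q' ih ih' =>
    simp only [TM2.stepAux, pushCount]
    cases f v
    · have := ih' v S; simp only [cond]; omega
    · have := ih v S; simp only [cond]; omega
  | goto f => simp [TM2.stepAux]
  | halt => simp [TM2.stepAux]

/-- A single step executes one statement, so it pushes at most as many letters as all statements of
the program contain pushes. This bounds the output length of a machine by its running time, which is
needed when its output is processed further. -/
theorem exists_length_stk_le [Fintype Λ] (m : Λ → TM2.Stmt Γ Λ σ) :
    ∃ C, ∀ (n : ℕ) (c c' : TM2.Cfg Γ Λ σ) (k : K),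
      (flip bind (TM2.step m))^[n] (some c) = some c' →
        (c'.stk k).length ≤ (c.stk k).length + C * n := by
  refine ⟨∑ l, pushCount (m l), fun n c c' k h => ?_⟩
  induction n generalizing c with
  | zero => cases h; simp
  | succ n ih =>
    rw [iterate_succ_apply] at h
    obtain ⟨_ | l, a, S⟩ := c
    · have : flip bind (TM2.step m) (some (⟨none, a, S⟩ : TM2.Cfg _ Λ σ)) = none := rfl
      rw [this, flip_bind_iterate_none] at h
      cases h
    · have h1 : flip bind (TM2.step m) (some (⟨some l, a, S⟩ : TM2.Cfg _ Λ σ)) =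
        some (TM2.stepAux (m l) a S) := rfl
      rw [h1] at h
      have h2 := ih _ h
      have h3 := length_stk_stepAux_le (m l) a S k
      have h4 : pushCount (m l) ≤ ∑ l, pushCount (m l) :=
        Finset.single_le_sum (f := fun l => pushCount (m l)) (fun _ _ => Nat.zero_le _)
          (Finset.mem_univ l)
      simp only [Nat.mul_succ]
      omega

end Growth

/-! ### Program fragments -/

variable {A B : FinTM2} {R : Type} [DecidableEq R]

/-- The stacks: registers, and the stacks of two embedded machines. -/
abbrev Stk (A B : FinTM2) (R : Type) : Type := R ⊕ (A.K ⊕ B.K)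

/-- The stack alphabets. -/
abbrev Sym (A B : FinTM2) (R : Type) : Stk A B R → Type :=
  Sum.elim (fun _ => Bool) (Sum.elim A.Γ B.Γ)

/-- The internal states: the letter read last, and the states of the embedded machines. -/
abbrev St (A B : FinTM2) : Type := Option Bool × A.σ × B.σ

/-- The contents of all stacks while the embedded machines are at rest. -/
def mem (S : R → List Bool) : ∀ k : Stk A B R, List (Sym A B R k)
  | .inl r => S r
  | .inr (.inl _) => []
  | .inr (.inr _) => []

theorem update_mem (S : R → List Bool) (r : R) (w : List Bool) :
    update (mem (A := A) (B := B) S) (.inl r) w = mem (update S r w) := by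
  funext k
  rcases k with k | k | k
  · by_cases h : k = r
    · subst h; exact (update_self _ _ _).trans (update_self (f := S) _ _).symm
    · exact (update_of_ne (by simpa using h) _ _).trans (update_of_ne (f := S) h _).symm
  · exact update_of_ne (by simp) _ _
  · exact update_of_ne (by simp) _ _

variable (A B R) in
/-- A program fragment with one entry and one exit, to be placed into a larger program. -/
structure Frag where
  /-- the labels of the fragment -/
  Λ : Type
  /-- there are finitely many labels -/
  fin : Fintype Λ
  /-- the entry -/
  entry : Λ
  /-- the code, given the position of the fragment in the larger program and the exit -/
  code : ∀ {L : Type}, (Λ → L) → L → Λ → TM2.Stmt (Sym A B R) L (St A B)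

/-- Started with register contents `S`, the fragment `p` reaches its exit with register contents
`S'` after at most `t` steps. -/
def Runs (p : Frag A B R) (S S' : R → List Bool) (t : ℕ) : Prop :=
  ∀ (L : Type) (emb : p.Λ → L) (exit : L) (m : L → TM2.Stmt (Sym A B R) L (St A B)),
    (∀ l, m (emb l) = p.code emb exit l) → ∀ s : Option Bool, ∃ s' : Option Bool,
      ReachIn m ⟨some (emb p.entry), (s, A.initialState, B.initialState), mem S⟩
        ⟨some exit, (s', A.initialState, B.initialState), mem S'⟩ t

theorem Runs.mono {p : Frag A B R} {S S' : R → List Bool} {t t' : ℕ} (h : Runs p S S' t)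
    (htt : t ≤ t') : Runs p S S' t' := fun L emb exit m hm s =>
  let ⟨s', h'⟩ := h L emb exit m hm s
  ⟨s', h'.mono htt⟩

theorem Runs.congr {p : Frag A B R} {S S' T T' : R → List Bool} {t t' : ℕ} (h : Runs p S S' t)
    (hS : T = S) (hS' : S' = T') (htt : t ≤ t') : Runs p T T' t' := by
  subst hS hS'; exact h.mono htt

/-- Do nothing. -/
def skip : Frag A B R where
  Λ := Unit
  fin := inferInstance
  entry := ()
  code _ exit _ := .goto fun _ => exit

theorem runs_skip (S : R → List Bool) : Runs (skip : Frag A B R) S S 1 :=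
  fun L emb exit m hm s => ⟨s, ReachIn.step (by rw [hm]; rfl)⟩

/-- Push the letter `b` onto register `r`. -/
def push (r : R) (b : Bool) : Frag A B R where
  Λ := Unit
  fin := inferInstance
  entry := ()
  code _ exit _ := .push (.inl r) (fun _ => b) (.goto fun _ => exit)

theorem runs_push (r : R) (b : Bool) (S : R → List Bool) :
    Runs (push r b : Frag A B R) S (update S r (b :: S r)) 1 :=
  fun L emb exit m hm s => ⟨s, ReachIn.step (by
    rw [hm, ← update_mem]; rfl)⟩

/-- One fragment after another. -/
def seq (p q : Frag A B R) : Frag A B R where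
  Λ := p.Λ ⊕ q.Λ
  fin := letI := p.fin; letI := q.fin; inferInstance
  entry := .inl p.entry
  code emb exit l := match l with
    | .inl l => p.code (fun l => emb (.inl l)) (emb (.inr q.entry)) l
    | .inr l => q.code (fun l => emb (.inr l)) exit l

/-- Since `Runs` quantifies over all programs that contain the fragment, both runs can be taken in
the same program `m`, and no code has to be relocated. -/
theorem Runs.seq {p q : Frag A B R} {S S' S'' : R → List Bool} {t t' : ℕ} (h : Runs p S S' t)
    (h' : Runs q S' S'' t') : Runs (seq p q) S S'' (t + t') := fun L emb exit m hm s => by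
  obtain ⟨s', h1⟩ := h L (fun l => emb (.inl l)) (emb (.inr q.entry)) m (fun l => hm _) s
  obtain ⟨s'', h2⟩ := h' L (fun l => emb (.inr l)) exit m (fun l => hm _) s'
  exact ⟨s'', h1.trans h2⟩

/-- Pop a letter from register `r` and continue according to the result. -/
def pop (r : R) (p : Option Bool → Frag A B R) : Frag A B R where
  Λ := Option (Σ o, (p o).Λ)
  fin := letI := fun o => (p o).fin; inferInstance
  entry := none
  code emb exit l := match l with
    | none => .pop (.inl r) (fun v o => (o, v.2)) (.goto fun v => emb (some ⟨v.1, (p v.1).entry⟩))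
    | some ⟨o, l⟩ => (p o).code (fun l => emb (some ⟨o, l⟩)) exit l

theorem Runs.pop {r : R} {p : Option Bool → Frag A B R} {S S' : R → List Bool} {t : ℕ}
    (h : Runs (p (S r).head?) (update S r (S r).tail) S' t) :
    Runs (pop r p) S S' (t + 1) := fun L emb exit m hm s => by
  obtain ⟨s', h1⟩ := h L (fun l => emb (some ⟨_, l⟩)) exit m (fun l => hm _) (S r).head?
  refine ⟨s', ((ReachIn.step ?_).trans h1).mono (by omega)⟩
  rw [hm, ← update_mem]
  rfl

/-- Pop letters from register `r`, until a result satisfies `halts`; after each of the others,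
execute a fragment. -/
def loop (r : R) (halts : Option Bool → Bool) (p : Option Bool → Frag A B R) : Frag A B R where
  Λ := Option (Σ o, (p o).Λ)
  fin := letI := fun o => (p o).fin; inferInstance
  entry := none
  code emb exit l := match l with
    | none => .pop (.inl r) (fun v o => (o, v.2))
        (.goto fun v => bif halts v.1 then exit else emb (some ⟨v.1, (p v.1).entry⟩))
    | some ⟨o, l⟩ => (p o).code (fun l => emb (some ⟨o, l⟩)) (emb none) l

/-- The letter that ends the loop is consumed as well; `decodeTo` uses this to remove the end mark
of a word. -/
theorem runs_loop_exit {r : R} {halts : Option Bool → Bool} {p : Option Bool → Frag A B R}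
    {S : R → List Bool} (h : halts (S r).head? = true) :
    Runs (loop r halts p) S (update S r (S r).tail) 1 := fun L emb exit m hm s => by
  refine ⟨(S r).head?, ReachIn.step ?_⟩
  rw [hm, ← update_mem]
  have h' : halts (mem (A := A) (B := B) S (.inl r)).head? = true := h
  simp only [loop, TM2.stepAux, h', cond]
  rfl

theorem Runs.loop_step {r : R} {halts : Option Bool → Bool} {p : Option Bool → Frag A B R}
    {S S' S'' : R → List Bool} {t t' : ℕ} (h : halts (S r).head? = false)
    (h1 : Runs (p (S r).head?) (update S r (S r).tail) S' t)
    (h2 : Runs (loop r halts p) S' S'' t') :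
    Runs (loop r halts p) S S'' (t + t' + 1) := fun L emb exit m hm s => by
  obtain ⟨s', h1⟩ := h1 L (fun l => emb (some ⟨_, l⟩)) (emb none) m (fun l => hm _) (S r).head?
  obtain ⟨s'', h2⟩ := h2 L emb exit m hm s'
  refine ⟨s'', ((ReachIn.step ?_).trans (h1.trans h2)).mono (by omega)⟩
  rw [hm, ← update_mem]
  have h' : halts (mem (A := A) (B := B) S (.inl r)).head? = false := h
  simp only [loop, TM2.stepAux, h', cond]
  rfl

/-! ### Calls of the embedded machines -/

variable (A B R) in
/-- A component of the memory, given by some of the stacks and a part of the internal state. -/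
structure Slot where
  /-- the stacks -/
  K₀ : Type
  /-- equality of stacks is decidable -/
  dec : DecidableEq K₀
  /-- the position of the stacks -/
  ι : K₀ → Stk A B R
  /-- the internal states -/
  σ₀ : Type
  /-- the internal state at rest -/
  init : σ₀
  /-- the internal state of the component -/
  get : St A B → σ₀
  /-- the modification of the internal state of the component -/
  set : σ₀ → St A B → St A B
  /-- the stacks, given the registers and the stacks of the component -/
  ov : (R → List Bool) → (∀ k, List (Sym A B R (ι k))) → ∀ k, List (Sym A B R k)
  get_set : ∀ a v, get (set a v) = a
  set_set : ∀ a b v, set a (set b v) = set a v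
  set_init : ∀ s, set init (s, A.initialState, B.initialState) =
    (s, A.initialState, B.initialState)
  ov_ι : ∀ T S k, ov T S (ι k) = S k
  update_ov : ∀ T S k x, update (ov T S) (ι k) x = ov T (update S k x)
  ov_inl : ∀ T S r, ov T S (.inl r) = T r
  update_ov_inl : ∀ T S r x, update (ov T S) (.inl r) x = ov (update T r x) S
  ov_nil : ∀ T, ov T (fun _ => []) = mem T

attribute [instance] Slot.dec

/-- The slot of the first machine. -/
def slotA (A B : FinTM2) (R : Type) [DecidableEq R] : Slot A B R where
  K₀ := A.K
  dec := inferInstance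
  ι k := .inr (.inl k)
  σ₀ := A.σ
  init := A.initialState
  get v := v.2.1
  set a v := (v.1, a, v.2.2)
  ov T S k := match k with
    | .inl r => T r
    | .inr (.inl k) => S k
    | .inr (.inr _) => []
  get_set _ _ := rfl
  set_set _ _ _ := rfl
  set_init _ := rfl
  ov_ι _ _ _ := rfl
  update_ov T S k x := by
    funext j
    rcases j with j | j | j
    · exact update_of_ne (by simp) _ _
    · by_cases h : j = k
      · subst h; exact (update_self _ _ _).trans (update_self (f := S) _ _).symm
      · exact (update_of_ne (by simpa using h) _ _).trans (update_of_ne (f := S) h _).symm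
    · exact update_of_ne (by simp) _ _
  ov_inl _ _ _ := rfl
  update_ov_inl T S k x := by
    funext j
    rcases j with j | j | j
    · by_cases h : j = k
      · subst h; exact (update_self _ _ _).trans (update_self (f := T) _ _).symm
      · exact (update_of_ne (by simpa using h) _ _).trans (update_of_ne (f := T) h _).symm
    · exact update_of_ne (by simp) _ _
    · exact update_of_ne (by simp) _ _
  ov_nil T := by funext k; rcases k with k | k | k <;> rfl

/-- The slot of the second machine. -/
def slotB (A B : FinTM2) (R : Type) [DecidableEq R] : Slot A B R where
  K₀ := B.K
  dec := inferInstance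
  ι k := .inr (.inr k)
  σ₀ := B.σ
  init := B.initialState
  get v := v.2.2
  set a v := (v.1, v.2.1, a)
  ov T S k := match k with
    | .inl r => T r
    | .inr (.inl _) => []
    | .inr (.inr k) => S k
  get_set _ _ := rfl
  set_set _ _ _ := rfl
  set_init _ := rfl
  ov_ι _ _ _ := rfl
  update_ov T S k x := by
    funext j
    rcases j with j | j | j
    · exact update_of_ne (by simp) _ _
    · exact update_of_ne (by simp) _ _
    · by_cases h : j = k
      · subst h; exact (update_self _ _ _).trans (update_self (f := S) _ _).symm
      · exact (update_of_ne (by simpa using h) _ _).trans (update_of_ne (f := S) h _).symm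
  ov_inl _ _ _ := rfl
  update_ov_inl T S k x := by
    funext j
    rcases j with j | j | j
    · by_cases h : j = k
      · subst h; exact (update_self _ _ _).trans (update_self (f := T) _ _).symm
      · exact (update_of_ne (by simpa using h) _ _).trans (update_of_ne (f := T) h _).symm
    · exact update_of_ne (by simp) _ _
    · exact update_of_ne (by simp) _ _
  ov_nil T := by funext k; rcases k with k | k | k <;> rfl

variable (A B R) in
/-- A machine with binary input and output which works in a slot. -/
structure Callee extends Slot A B R where
  /-- the labels -/
  Λ₀ : Type
  /-- there are finitely many labels -/
  fin : Fintype Λ₀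
  /-- the input stack -/
  k₀ : K₀
  /-- the output stack -/
  k₁ : K₀
  /-- the input alphabet -/
  e₀ : Sym A B R (ι k₀) ≃ Bool
  /-- the output alphabet -/
  e₁ : Sym A B R (ι k₁) ≃ Bool
  /-- the initial label -/
  main : Λ₀
  /-- the program -/
  m : Λ₀ → TM2.Stmt (fun k => Sym A B R (ι k)) Λ₀ σ₀

/-- The machine turns the word `w` into the word `w'` in at most `t` steps. -/
def Callee.Outputs (M : Callee A B R) (w w' : List Bool) (t : ℕ) : Prop :=
  ∃ n ≤ t, (flip bind (TM2.step M.m))^[n]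
    (some ⟨some M.main, M.init, update (fun _ => []) M.k₀ (w.map M.e₀.symm)⟩) =
    some ⟨none, M.init, update (fun _ => []) M.k₁ (w'.map M.e₁.symm)⟩

/-- Move the contents of register `a` to the input stack of the machine, run the machine, and move
its output to register `b`. -/
def call (M : Callee A B R) (a b : R) : Frag A B R where
  Λ := Option (Option M.Λ₀)
  fin := letI := M.fin; inferInstance
  entry := none
  code emb exit l := match l with
    | none => .pop (.inl a) (fun v o => (o, v.2)) (.branch (fun v => v.1.isSome)
        (.push (M.ι M.k₀) (fun v => M.e₀.symm (v.1.getD false)) (.goto fun _ => emb none))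
        (.goto fun _ => emb (some (some M.main))))
    | some none => .pop (M.ι M.k₁) (fun v o => (o.map M.e₁, v.2)) (.branch (fun v => v.1.isSome)
        (.push (.inl b) (fun v => v.1.getD false) (.goto fun _ => emb (some none)))
        (.goto fun _ => exit))
    | some (some l) => embedStmt M.ι M.get M.set (fun l => emb (some (some l))) (emb (some none))
        (M.m l)

section Call

variable {M : Callee A B R} {a b : R} {L : Type} {emb : Option (Option M.Λ₀) → L} {exit : L}
  {m : L → TM2.Stmt (Sym A B R) L (St A B)}

/-- The accumulator `acc`, the registers and the last letter `s` all change during the transfer, so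
the induction is over all of them. -/
theorem reachIn_call_input (hm : ∀ l, m (emb l) = (call M a b).code emb exit l)
    (w : List Bool) (acc : List (Sym A B R (M.ι M.k₀))) (T : R → List Bool) (hT : T a = w)
    (s : Option Bool) :
    ReachIn m ⟨some (emb none), (s, A.initialState, B.initialState),
        M.ov T (update (fun _ => []) M.k₀ acc)⟩
      ⟨some (emb (some (some M.main))), (none, A.initialState, B.initialState),
        M.ov (update T a []) (update (fun _ => []) M.k₀ ((w.map M.e₀.symm).reverse ++ acc))⟩
      (w.length + 1) := by
  induction w generalizing acc T s with
  | nil =>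
    refine ReachIn.cons (hm none) ?_ (ReachIn.refl _ _)
    simp [call, TM2.stepAux, M.ov_inl, hT]
    exact M.update_ov_inl _ _ _ _
  | cons x w ih =>
    have := ih (M.e₀.symm x :: acc) (update T a w) (update_self _ _ _) (some x)
    rw [update_idem] at this
    rw [List.map_cons, List.reverse_cons, List.append_assoc]
    refine ReachIn.cons (hm none) ?_ this
    have h := M.update_ov_inl T (update (fun _ => []) M.k₀ acc) a w
    simp [call, TM2.stepAux, M.ov_inl, hT]
    rw [h, M.ov_ι, M.update_ov, update_self, update_idem]

theorem reachIn_call_output (hm : ∀ l, m (emb l) = (call M a b).code emb exit l)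
    (w : List Bool) (T : R → List Bool) (s : Option Bool) :
    ReachIn m ⟨some (emb (some none)), (s, A.initialState, B.initialState),
        M.ov T (update (fun _ => []) M.k₁ (w.map M.e₁.symm))⟩
      ⟨some exit, (none, A.initialState, B.initialState),
        mem (update T b (w.reverse ++ T b))⟩
      (w.length + 1) := by
  induction w generalizing T s with
  | nil =>
    refine ReachIn.cons (hm (some none)) ?_ (ReachIn.refl _ _)
    simp [call, TM2.stepAux, M.ov_ι, M.update_ov, ← M.ov_nil]
  | cons x w ih =>
    have := ih (update T b (x :: T b)) (some x)
    rw [update_idem, update_self] at this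
    rw [List.reverse_cons, List.append_assoc]
    refine ReachIn.cons (hm (some none)) ?_ this
    simp [call, TM2.stepAux, M.ov_ι, M.update_ov, M.ov_inl]
    exact M.update_ov_inl _ _ _ _

end Call

/-- Moving a stack onto another reverses it, so the argument must be stored in reverse and the
result arrives in reverse. By `Callee.Outputs` the machine ends in its initial state with only its
output stack filled; once that is emptied the memory has the form `mem` again. -/
theorem runs_call (M : Callee A B R) {a b : R} (hab : a ≠ b) {w w' : List Bool} {t : ℕ}
    (h : M.Outputs w w' t) (S : R → List Bool) (hS : S a = w.reverse) :
    Runs (call M a b) S (update (update S a []) b (w'.reverse ++ S b))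
      (w.length + t + w'.length + 2) := fun L emb exit m hm s => by
  obtain ⟨n, hn, e⟩ := h
  have h1 := reachIn_call_input hm _ [] S hS s
  have h2 := reachIn_embedCfg (emb := fun l => emb (some (some l))) (exit := emb (some none))
    M.get_set M.set_set (M.ov_ι (update S a [])) (M.update_ov (update S a []))
    (none, A.initialState, B.initialState) M.m m (fun l => hm _) n _ _ e
  have h3 := reachIn_call_output hm w' (update S a []) none
  simp only [embedCfg, M.set_init, Option.elim] at h2
  refine ⟨none, ?_⟩
  have e1 : M.ov S (update (fun _ => []) M.k₀ []) = mem S := by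
    rw [← M.ov_nil, update_eq_self_iff.2 rfl]
  rw [e1] at h1
  rw [update_of_ne hab.symm] at h3
  simp only [List.map_reverse, List.reverse_reverse, List.append_nil] at h1
  refine ((h1.trans h2).trans h3).mono ?_
  simp; omega

/-! ### Programs as Turing machines -/

/-- The machine which executes `p`, with input register `i` and output register `o`. -/
def toFinTM2 [Fintype R] (p : Frag A B R) (i o : R) [Fintype A.K] [Fintype B.K] [Fintype A.σ]
    [Fintype B.σ] : FinTM2 where
  K := Stk A B R
  k₀ := .inl i
  k₁ := .inl o
  Γ := Sym A B R
  Λ := Option p.Λ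
  main := some p.entry
  ΛFin := letI := p.fin; inferInstance
  σ := St A B
  initialState := (none, A.initialState, B.initialState)
  Γk₀Fin := inferInstanceAs (Fintype Bool)
  m l := match l with
    | some l => p.code some none l
    | none => .load (fun v => (none, v.2)) .halt

theorem initList_toFinTM2 [Fintype R] (p : Frag A B R) (i o : R) [Fintype A.K] [Fintype B.K]
    [Fintype A.σ] [Fintype B.σ] (w : List Bool) :
    initList (toFinTM2 p i o) w = ⟨some (some p.entry), (none, A.initialState, B.initialState),
      mem (update (fun _ => []) i w)⟩ := by
  refine congrArg (TM2.Cfg.mk _ _) ?_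
  rw [← update_mem]
  funext k
  by_cases h : k = .inl i
  · subst h
    have : update (mem (A := A) (B := B) fun _ => []) (.inl i) w (.inl i) = w :=
      update_self _ _ _
    exact (dif_pos rfl).trans this.symm
  · have : update (mem (A := A) (B := B) fun _ => []) (.inl i) w k = [] := by
      exact (update_of_ne h _ _).trans (by rcases k with k | k | k <;> rfl)
    exact (dif_neg h).trans this.symm

theorem haltList_toFinTM2 [Fintype R] (p : Frag A B R) (i o : R) [Fintype A.K] [Fintype B.K]
    [Fintype A.σ] [Fintype B.σ] (w : List Bool) :
    haltList (toFinTM2 p i o) w = ⟨none, (none, A.initialState, B.initialState),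
      mem (update (fun _ => []) o w)⟩ := by
  refine congrArg (TM2.Cfg.mk _ _) ?_
  rw [← update_mem]
  funext k
  by_cases h : k = .inl o
  · subst h
    have : update (mem (A := A) (B := B) fun _ => []) (.inl o) w (.inl o) = w :=
      update_self _ _ _
    exact (dif_pos rfl).trans this.symm
  · have : update (mem (A := A) (B := B) fun _ => []) (.inl o) w k = [] := by
      exact (update_of_ne h _ _).trans (by rcases k with k | k | k <;> rfl)
    exact (dif_neg h).trans this.symm

theorem polyTime_of_runs [Fintype R] {p : Frag A B R} {i o : R} [Fintype A.K] [Fintype B.K]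
    [Fintype A.σ] [Fintype B.σ] {α : Type} {eb : α → List Bool} {g : List Bool → α}
    (q : Polynomial ℕ)
    (h : ∀ w : List Bool, Runs p (update (fun _ => []) i w) (update (fun _ => []) o (eb (g w)))
      (q.eval w.length)) :
    Nonempty (TM2ComputableInPolyTime (id : List Bool → List Bool) eb g) := by
  -- The additional step is the one at the final label, which erases the last letter read: a halting
  -- configuration must carry the initial state.
  refine ⟨⟨⟨toFinTM2 p i o, Equiv.refl _, Equiv.refl _⟩, q + 1, fun w => ?_⟩⟩
  have hr : ReachIn (toFinTM2 p i o).m (initList (toFinTM2 p i o) w)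
      (haltList (toFinTM2 p i o) (eb (g w))) (q.eval w.length + 1) := by
    obtain ⟨s', h1⟩ := h w _ some none (toFinTM2 p i o).m (fun l => rfl) none
    have h2 : ReachIn (toFinTM2 p i o).m
        ⟨some none, (s', A.initialState, B.initialState), mem (update (fun _ => []) o (eb (g w)))⟩
        ⟨none, (none, A.initialState, B.initialState),
          mem (update (fun _ => []) o (eb (g w)))⟩ 1 := ReachIn.step rfl
    rw [initList_toFinTM2, haltList_toFinTM2]
    exact h1.trans h2
  have e : ∀ l : List Bool, List.map id l = l := List.map_id
  refine ⟨⟨hr.choose, ?_⟩, by simpa using hr.choose_spec.1⟩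
  exact (congrArg (fun l => (flip bind (toFinTM2 p i o).step)^[hr.choose]
    (some (initList (toFinTM2 p i o) l))) (e w)).trans (hr.choose_spec.2.trans
      (congrArg (fun l => some (haltList (toFinTM2 p i o) l)) (e (eb (g w))).symm))

/-! ### Polynomial-time machines as callees -/

/-- The first machine as a callee. -/
def calleeA (A B : FinTM2) (R : Type) [DecidableEq R] (e₀ : A.Γ A.k₀ ≃ Bool)
    (e₁ : A.Γ A.k₁ ≃ Bool) : Callee A B R where
  toSlot := slotA A B R
  Λ₀ := A.Λ
  fin := A.ΛFin
  k₀ := A.k₀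
  k₁ := A.k₁
  e₀ := e₀
  e₁ := e₁
  main := A.main
  m := A.m

/-- The second machine as a callee. -/
def calleeB (A B : FinTM2) (R : Type) [DecidableEq R] (e₀ : B.Γ B.k₀ ≃ Bool)
    (e₁ : B.Γ B.k₁ ≃ Bool) : Callee A B R where
  toSlot := slotB A B R
  Λ₀ := B.Λ
  fin := B.ΛFin
  k₀ := B.k₀
  k₁ := B.k₁
  e₀ := e₀
  e₁ := e₁
  main := B.main
  m := B.m

theorem initList_eq (M : FinTM2) (w : List (M.Γ M.k₀)) :
    initList M w = ⟨some M.main, M.initialState, update (fun _ => []) M.k₀ w⟩ := by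
  refine congrArg (TM2.Cfg.mk _ _) ?_
  funext k
  by_cases h : k = M.k₀
  · subst h; exact (dif_pos rfl).trans (update_self (f := fun _ => []) _ _).symm
  · exact (dif_neg h).trans (update_of_ne (f := fun _ => []) h _).symm

theorem haltList_eq (M : FinTM2) (w : List (M.Γ M.k₁)) :
    haltList M w = ⟨none, M.initialState, update (fun _ => []) M.k₁ w⟩ := by
  refine congrArg (TM2.Cfg.mk _ _) ?_
  funext k
  by_cases h : k = M.k₁
  · subst h; exact (dif_pos rfl).trans (update_self (f := fun _ => []) _ _).symm
  · exact (dif_neg h).trans (update_of_ne (f := fun _ => []) h _).symm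

theorem eval_mono (p : Polynomial ℕ) {a b : ℕ} (h : a ≤ b) : p.eval a ≤ p.eval b := by
  rw [Polynomial.eval_eq_sum, Polynomial.eval_eq_sum]
  exact Finset.sum_le_sum fun i _ => Nat.mul_le_mul_left _ (Nat.pow_le_pow_left h i)

/-- One polynomial serves for the time and for the output length; the latter exceeds the input
length by at most `C` letters per step. -/
theorem exists_polynomial_outputs {α : Type} {eb : α → List Bool} {f : List Bool → α}
    (h : TM2ComputableInPolyTime (id : List Bool → List Bool) eb f) :
    ∃ p : Polynomial ℕ, ∀ w : List Bool, (∃ n ≤ p.eval w.length,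
      (flip bind (TM2.step h.tm.m))^[n] (some ⟨some h.tm.main, h.tm.initialState,
        update (fun _ => []) h.tm.k₀ (w.map h.inputAlphabet.symm)⟩) =
      some ⟨none, h.tm.initialState,
        update (fun _ => []) h.tm.k₁ ((eb (f w)).map h.outputAlphabet.symm)⟩) ∧
      (eb (f w)).length ≤ p.eval w.length := by
  let := h.tm.ΛFin
  obtain ⟨C, hC⟩ := exists_length_stk_le h.tm.m
  refine ⟨Polynomial.X + (Polynomial.C C + 1) * h.time, fun w => ?_⟩
  obtain ⟨⟨n, e⟩, hn⟩ := h.outputsFun w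
  have e' : (flip bind (TM2.step h.tm.m))^[n] (some ⟨some h.tm.main, h.tm.initialState,
      update (fun _ => []) h.tm.k₀ (w.map h.inputAlphabet.symm)⟩) =
      some ⟨none, h.tm.initialState,
        update (fun _ => []) h.tm.k₁ ((eb (f w)).map h.outputAlphabet.symm)⟩ := by
    rw [← initList_eq, ← haltList_eq]
    exact e
  have hn' : n ≤ h.time.eval w.length := hn
  have hl := hC n _ _ h.tm.k₁ e'
  dsimp only at hl
  rw [update_self, List.length_map] at hl
  -- Input and output stack may be the same, in which case the output stack is not empty at the
  -- start. This is the origin of the summand `Polynomial.X`.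
  have hl' : (update (fun _ => []) h.tm.k₀ (w.map h.inputAlphabet.symm) h.tm.k₁ :
      List _).length ≤ w.length := by
    by_cases hk : h.tm.k₁ = h.tm.k₀
    · rw [hk, update_self, List.length_map]
    · rw [update_of_ne hk]; simp
  have hCn : C * n ≤ C * h.time.eval w.length := Nat.mul_le_mul_left _ hn'
  simp only [Polynomial.eval_add, Polynomial.eval_mul, Polynomial.eval_X, Polynomial.eval_C,
    add_mul, one_mul]
  exact ⟨⟨n, by omega, e'⟩, by omega⟩

/-- The callee `M` computes `f` in time and output length bounded by `p`. -/
def Callee.Computes {A B : FinTM2} (M : Callee A B R) (f : List Bool → List Bool)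
    (p : Polynomial ℕ) : Prop :=
  ∀ w, M.Outputs w (f w) (p.eval w.length) ∧ (f w).length ≤ p.eval w.length

theorem exists_computes_calleeA {α : Type} {eb : α → List Bool} {f : List Bool → α}
    (h : TM2ComputableInPolyTime (id : List Bool → List Bool) eb f) (B : FinTM2) :
    ∃ p, (calleeA h.tm B R h.inputAlphabet h.outputAlphabet).Computes (fun w => eb (f w)) p :=
  exists_polynomial_outputs h

theorem exists_computes_calleeB {α : Type} {eb : α → List Bool} {f : List Bool → α}
    (h : TM2ComputableInPolyTime (id : List Bool → List Bool) eb f) (A : FinTM2) :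
    ∃ p, (calleeB A h.tm R h.inputAlphabet h.outputAlphabet).Computes (fun w => eb (f w)) p :=
  exists_polynomial_outputs h

/-! ### Basic programs -/

/-- Apply a fragment to every letter of register `r`, from the top to the bottom. -/
def forEach (r : R) (p : Bool → Frag A B R) : Frag A B R :=
  loop r (fun o => o.isNone) fun o => p (o.getD false)

theorem runs_forEach_nil {r : R} {p : Bool → Frag A B R} {S : R → List Bool} (h : S r = []) :
    Runs (forEach r p) S S 1 := by
  refine (runs_loop_exit (by simp [h])).congr rfl ?_ le_rfl
  rw [h]; exact update_eq_self_iff.2 h.symm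

theorem Runs.forEach_cons {r : R} {p : Bool → Frag A B R} {S S' S'' : R → List Bool} {b : Bool}
    {w : List Bool} {t t' : ℕ} (h : S r = b :: w) (h1 : Runs (p b) (update S r w) S' t)
    (h2 : Runs (forEach r p) S' S'' t') : Runs (forEach r p) S S'' (t + t' + 1) := by
  refine Runs.loop_step (by simp [h]) ?_ h2
  simpa [h] using h1

/-- Empty a register. -/
def clear (r : R) : Frag A B R := forEach r fun _ => skip

theorem runs_clear (r : R) (S : R → List Bool) :
    Runs (clear r : Frag A B R) S (update S r []) (2 * (S r).length + 1) := by
  generalize hw : S r = w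
  induction w generalizing S with
  | nil => exact (runs_forEach_nil hw).congr rfl (by rw [← hw, update_eq_self]) (by simp)
  | cons b w ih =>
    exact (Runs.forEach_cons hw (runs_skip _) (ih (update S r w) (update_self _ _ _))).congr rfl
      (update_idem _ _ _) (by simp; omega)

/-- Move the contents of register `a` to register `b`, which reverses them. -/
def move (a b : R) : Frag A B R := forEach a fun x => push b x

theorem runs_move {a b : R} (hab : a ≠ b) (S : R → List Bool) :
    Runs (move a b : Frag A B R) S (update (update S a []) b ((S a).reverse ++ S b))
      (2 * (S a).length + 1) := by
  generalize hw : S a = w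
  induction w generalizing S with
  | nil =>
    have e : update S a [] = S := update_eq_self_iff.2 hw.symm
    exact (runs_forEach_nil hw).congr rfl (by simp [e]) (by simp)
  | cons x w ih =>
    refine (Runs.forEach_cons hw (runs_push _ _ _) (ih _ ?_)).congr rfl ?_ ?_
    · simp [hab]
    · simp [hab.symm, update_comm hab]
    · simp; omega

/-- Append the reversed code of the contents of register `a` to register `b`, keeping `a`. The
register `t` is used as temporary storage. -/
def encodeKeep (a t b : R) : Frag A B R :=
  seq (forEach a fun x => seq (push t x) (seq (push b true) (push b x)))
    (seq (push b false) (move t a))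

/-- The code lands on top of `b` in reverse, so successive calls build up the reversed code of a
tuple, the form in which `call` expects its argument. -/
theorem runs_encodeKeep {a t b : R} (hat : a ≠ t) (hab : a ≠ b) (htb : t ≠ b) (S : R → List Bool)
    (ht : S t = []) :
    Runs (encodeKeep a t b : Frag A B R) S
      (update S b ((MultiLayerBelief.encodeWord (S a)).reverse ++ S b))
      (6 * (S a).length + 3) := by
  have key : ∀ (w : List Bool) (S : R → List Bool), S a = w →
      Runs (forEach a fun x => seq (push t x) (seq (push b true) (push b x)) : Frag A B R) S
        (update (update (update S a []) t (w.reverse ++ S t)) b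
          ((w.flatMap fun x => [true, x]).reverse ++ S b)) (4 * w.length + 1) := by
    intro w
    induction w with
    | nil =>
      intro S hw
      have e : update S a [] = S := update_eq_self_iff.2 hw.symm
      exact (runs_forEach_nil hw).congr rfl (by simp [e]) (by simp)
    | cons x w ih =>
      intro S hw
      refine (Runs.forEach_cons hw ((runs_push _ _ _).seq ((runs_push _ _ _).seq
        (runs_push _ _ _))) (ih _ ?_)).congr rfl ?_ ?_
      · simp [hab, hat]
      · funext k
        by_cases h1 : k = b
        · subst h1; simp [htb.symm, hab.symm, List.flatMap_cons]
        by_cases h2 : k = t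
        · subst h2; simp [htb, hat.symm]
        by_cases h3 : k = a
        · subst h3; simp [hab, hat]
        simp [h1, h2, h3]
      · simp; omega
  refine ((key _ S rfl).seq ((runs_push _ _ _).seq (runs_move hat.symm _))).congr rfl ?_ ?_
  · funext k
    by_cases h1 : k = b
    · subst h1
      simp [htb.symm, hab.symm, MultiLayerBelief.encodeWord]
    by_cases h2 : k = t
    · subst h2; simp [htb, hat.symm, ht]
    by_cases h3 : k = a
    · subst h3; simp [hab, hat, htb, ht]
    simp [h1, h2, h3]
  · simp [htb, ht]; omega

/-- The first word of a sequence, and the rest of the sequence. On words which are not codes the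
result is immaterial. -/
def decodeWord : List Bool → List Bool × List Bool
  | true :: b :: s => (b :: (decodeWord s).1, (decodeWord s).2)
  | [true] => ([], [])
  | false :: s => ([], s)
  | [] => ([], [])

theorem decodeWord_encodeWord (w s : List Bool) :
    decodeWord (MultiLayerBelief.encodeWord w ++ s) = (w, s) := by
  induction w with
  | nil => rfl
  | cons b w ih =>
    have : decodeWord (MultiLayerBelief.encodeWord (b :: w) ++ s) =
      (b :: (decodeWord (MultiLayerBelief.encodeWord w ++ s)).1,
        (decodeWord (MultiLayerBelief.encodeWord w ++ s)).2) := by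
      simp [MultiLayerBelief.encodeWord, List.flatMap_cons, decodeWord]
    rw [this, ih]

/-- Each letter of a word takes two letters of its code. The estimate holds on all words, as it
must: the verifier has to be fast on inputs that are not codes, too. -/
theorem length_decodeWord_le (s : List Bool) :
    2 * (decodeWord s).1.length + (decodeWord s).2.length ≤ s.length := by
  induction s using decodeWord.induct with
  | case1 b s ih => simp [decodeWord]; omega
  | case2 => simp [decodeWord]
  | case3 s => simp [decodeWord]
  | case4 => simp [decodeWord]

theorem length_decodeWord_lt (s : List Bool) (h : s ≠ []) :
    (decodeWord s).2.length < s.length := by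
  rcases s with _ | ⟨_ | _, _ | ⟨b, s⟩⟩
  · exact absurd rfl h
  · simp [decodeWord]
  · simp [decodeWord]
  · simp [decodeWord]
  · have := length_decodeWord_le s
    simp [decodeWord]; omega

/-- Move the first word of the sequence in register `a` to register `b`. The register `t` is used as
temporary storage. -/
def decodeTo (a t b : R) : Frag A B R :=
  seq (loop a (fun o => !o.getD false) fun _ => pop a fun o => o.elim skip (push t)) (move t b)

theorem runs_decodeTo {a t b : R} (hat : a ≠ t) (hab : a ≠ b) (htb : t ≠ b) (S : R → List Bool)
    (ht : S t = []) :
    Runs (decodeTo a t b : Frag A B R) S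
      (update (update S a (decodeWord (S a)).2) b ((decodeWord (S a)).1 ++ S b))
      (5 * (S a).length + 5) := by
  have key : ∀ (w : List Bool) (S : R → List Bool), S a = w →
      Runs (loop a (fun o => !o.getD false) fun _ => pop a fun o => o.elim skip (push t) :
          Frag A B R) S
        (update (update S a (decodeWord w).2) t ((decodeWord w).1.reverse ++ S t))
        (3 * w.length + 1) := by
    intro w
    induction w using decodeWord.induct with
    | case1 b s ih =>
      intro S hw
      refine (Runs.loop_step (by simp [hw]) (Runs.pop
        (S' := update (update S a s) t (b :: S t)) (t := 1) ?_) (ih _ ?_)).congr rfl ?_ ?_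
      · simp only [hw, update_self, update_idem, List.head?, List.tail, Option.elim]
        exact (runs_push _ _ _).congr rfl (by simp [hat.symm]) le_rfl
      · simp [hat]
      · simp [decodeWord, update_comm hat]
      · simp; omega
    | case2 =>
      intro S hw
      -- A lone `true`: the inner pop finds nothing, and the next outer pop reads the empty register
      -- as `false`, which ends the loop.
      refine (Runs.loop_step (by simp [hw]) (Runs.pop
        (S' := update S a []) (t := 1) ?_) (runs_loop_exit ?_)).congr rfl ?_ ?_
      · simp only [hw, update_self, update_idem, List.head?, List.tail, Option.elim]
        exact runs_skip _
      · simp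
      · simp [decodeWord, hat.symm]
      · simp
    | case3 s =>
      intro S hw
      refine (runs_loop_exit (by simp [hw])).congr rfl ?_ (by simp)
      simp [hw, decodeWord, hat.symm]
    | case4 =>
      intro S hw
      refine (runs_loop_exit (by simp [hw])).congr rfl ?_ (by simp)
      simp [hw, decodeWord, hat.symm]
  refine ((key _ S rfl).seq (runs_move htb _)).congr rfl ?_ ?_
  · funext k
    by_cases h1 : k = b
    · subst h1
      simp [htb.symm, hab.symm, ht]
    by_cases h2 : k = t
    · subst h2; simp [htb, hat.symm, ht]
    by_cases h3 : k = a
    · subst h3; simp [hab, hat]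
    simp [h1, h2, h3]
  · have := length_decodeWord_le (S a)
    simp [ht]; omega

/-! ### The registers -/

/-- The contents of seventeen registers. -/
structure Regs where
  /-- register 0 -/
  r0 : List Bool
  /-- register 1 -/
  r1 : List Bool
  /-- register 2 -/
  r2 : List Bool
  /-- register 3 -/
  r3 : List Bool
  /-- register 4 -/
  r4 : List Bool
  /-- register 5 -/
  r5 : List Bool
  /-- register 6 -/
  r6 : List Bool
  /-- register 7 -/
  r7 : List Bool
  /-- register 8 -/
  r8 : List Bool
  /-- register 9 -/
  r9 : List Bool
  /-- register 10 -/
  r10 : List Bool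
  /-- register 11 -/
  r11 : List Bool
  /-- register 12 -/
  r12 : List Bool
  /-- register 13 -/
  r13 : List Bool
  /-- register 14 -/
  r14 : List Bool
  /-- register 15 -/
  r15 : List Bool
  /-- register 16 -/
  r16 : List Bool

/-- The contents of the registers as a function. -/
def Regs.get (M : Regs) : Fin 17 → List Bool :=
  ![M.r0, M.r1, M.r2, M.r3, M.r4, M.r5, M.r6, M.r7, M.r8, M.r9, M.r10, M.r11, M.r12, M.r13, M.r14,
    M.r15, M.r16]

/-- Turns updates of the register function into updates of a record, so that register contents after
a fragment can be compared by `simp` and `rfl`. -/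
theorem update_get (M : Regs) (w : List Bool) :
    update M.get 0 w = {M with r0 := w}.get ∧
    update M.get 1 w = {M with r1 := w}.get ∧
    update M.get 2 w = {M with r2 := w}.get ∧
    update M.get 3 w = {M with r3 := w}.get ∧
    update M.get 4 w = {M with r4 := w}.get ∧
    update M.get 5 w = {M with r5 := w}.get ∧
    update M.get 6 w = {M with r6 := w}.get ∧
    update M.get 7 w = {M with r7 := w}.get ∧
    update M.get 8 w = {M with r8 := w}.get ∧
    update M.get 9 w = {M with r9 := w}.get ∧
    update M.get 10 w = {M with r10 := w}.get ∧
    update M.get 11 w = {M with r11 := w}.get ∧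
    update M.get 12 w = {M with r12 := w}.get ∧
    update M.get 13 w = {M with r13 := w}.get ∧
    update M.get 14 w = {M with r14 := w}.get ∧
    update M.get 15 w = {M with r15 := w}.get ∧
    update M.get 16 w = {M with r16 := w}.get := by
  refine ⟨?_, ?_, ?_, ?_, ?_, ?_, ?_, ?_, ?_, ?_, ?_, ?_, ?_, ?_, ?_, ?_, ?_⟩ <;>
    (funext k; fin_cases k <;> rfl)

/-! ### Reading random digits -/

/-- The digits of `a` at the positions below `n` where it differs from `y`, the last position first,
on top of `l`. -/
def cmpStack : ℕ → List Bool → List Bool → List Bool → List Bool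
  | 0, _, _, l => l
  | n + 1, y, a, l => cmpStack n y.tail a.tail
      (if y.head?.getD false = a.head?.getD false then l else a.head?.getD false :: l)

theorem length_cmpStack_le (n : ℕ) (y a l : List Bool) :
    (cmpStack n y a l).length ≤ l.length + n := by
  induction n generalizing y a l with
  | zero => simp [cmpStack]
  | succ n ih =>
    refine (ih _ _ _).trans ?_
    split_ifs <;> simp; omega

/-- In this and the following variants the register contents enter through equations, which `rfl`,
`decide` and `update_get` settle for concrete registers. -/
theorem runs_decodeTo_of {a t b : Fin 17} {S T : Fin 17 → List Bool} (w : List Bool) (hat : a ≠ t)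
    (hab : a ≠ b) (htb : t ≠ b) (ha : S a = w) (ht : S t = []) (hb : S b = [])
    (hT : update (update S a (decodeWord w).2) b (decodeWord w).1 = T) :
    Runs (decodeTo a t b : Frag A B (Fin 17)) S T (5 * w.length + 5) := by
  subst ha
  exact (runs_decodeTo hat hab htb S ht).congr rfl (by rw [hb, List.append_nil, hT]) le_rfl

theorem runs_clear_of {r : Fin 17} {S T : Fin 17 → List Bool} (w : List Bool) (hr : S r = w)
    (hT : update S r [] = T) : Runs (clear r : Frag A B (Fin 17)) S T (2 * w.length + 1) := by
  subst hr hT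
  exact runs_clear r S

theorem runs_move_of {a b : Fin 17} {S T : Fin 17 → List Bool} (w : List Bool) (hab : a ≠ b)
    (ha : S a = w) (hb : S b = []) (hT : update (update S a []) b w.reverse = T) :
    Runs (move a b : Frag A B (Fin 17)) S T (2 * w.length + 1) := by
  subst ha
  exact (runs_move hab S).congr rfl (by rw [hb, List.append_nil, hT]) le_rfl

theorem runs_encodeKeep_of {a t b : Fin 17} {S T : Fin 17 → List Bool} (w v : List Bool)
    (hat : a ≠ t) (hab : a ≠ b) (htb : t ≠ b) (ha : S a = w) (ht : S t = []) (hb : S b = v)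
    (hT : update S b ((MultiLayerBelief.encodeWord w).reverse ++ v) = T) :
    Runs (encodeKeep a t b : Frag A B (Fin 17)) S T (6 * w.length + 3) := by
  subst ha hb hT
  exact runs_encodeKeep hat hab htb S ht

theorem runs_call_of (M : Callee A B (Fin 17)) {a b : Fin 17} {S T : Fin 17 → List Bool}
    (hab : a ≠ b) {w w' : List Bool} {t : ℕ} (h : M.Outputs w w' t) (ha : S a = w.reverse)
    (hb : S b = []) (hT : update (update S a []) b w'.reverse = T) :
    Runs (call M a b) S T (w.length + t + w'.length + 2) := by
  subst hT
  exact (runs_call M hab h S ha).congr rfl (by rw [hb, List.append_nil]) le_rfl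

/-- Record the digit `a` in register `r` if it differs from `u`. -/
def cmpStep (r : Fin 17) (u a : Bool) : Frag A B (Fin 17) :=
  if u = a then skip else push r a

theorem runs_cmpStep (r : Fin 17) (u a : Bool) (S : Fin 17 → List Bool) :
    Runs (cmpStep r u a : Frag A B (Fin 17)) S
      (update S r (if u = a then S r else a :: S r)) 1 := by
  unfold cmpStep
  split_ifs
  · exact (runs_skip S).congr rfl (by simp) le_rfl
  · exact runs_push _ _ _

/-- Compare the number in register 2 with those in the registers 10 and 11. -/
def cmpDigits : Frag A B (Fin 17) :=
  forEach 11 fun d => pop 2 fun u => pop 10 fun a =>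
    seq (cmpStep 12 (u.getD false) (a.getD false)) (cmpStep 13 (u.getD false) d)

/-- The denominator in register 11 fixes the number of digits; `getD false` pads the other two
numbers by zeros if they are shorter. Both comparisons read the same digits of register 2, hence are
made in one pass. -/
theorem runs_cmpDigits (M : Regs) :
    Runs (cmpDigits : Frag A B (Fin 17)) M.get
      {M with
        r2 := M.r2.drop M.r11.length
        r10 := M.r10.drop M.r11.length
        r11 := []
        r12 := cmpStack M.r11.length M.r2 M.r10 M.r12
        r13 := cmpStack M.r11.length M.r2 M.r11 M.r13}.get (5 * M.r11.length + 1) := by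
  generalize hd : M.r11 = d
  induction d generalizing M with
  | nil =>
    refine (runs_forEach_nil (S := M.get) (r := 11) hd).congr rfl ?_ (by simp)
    conv_lhs => rw [show M = {M with r11 := []} by rw [← hd]]
    rfl
  | cons x d ih =>
    have hb : Runs (pop 2 fun u => pop 10 fun a =>
          seq (cmpStep 12 (u.getD false) (a.getD false)) (cmpStep 13 (u.getD false) x) :
          Frag A B (Fin 17)) (update M.get 11 d)
        {M with
          r2 := M.r2.tail
          r10 := M.r10.tail
          r11 := d
          r12 := if M.r2.head?.getD false = M.r10.head?.getD false then M.r12 else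
            M.r10.head?.getD false :: M.r12
          r13 := if M.r2.head?.getD false = x then M.r13 else x :: M.r13}.get 4 :=
      (Runs.pop (Runs.pop ((runs_cmpStep _ _ _ _).seq (runs_cmpStep _ _ _ _)))).congr rfl
        (by simp only [update_get]; rfl) le_rfl
    refine (Runs.forEach_cons (S := M.get) (r := 11) hd hb (ih _ rfl)).congr rfl ?_ ?_
    · simp [cmpStack]
      rfl
    · simp; omega

/-- Read the next entry of the evidence frame in register 7, compare the corresponding digits of
register 2 with it, record in register 8 whether the number is less than the numerator, and mark
register 14 if it is not less than the denominator. -/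
def readEvidence : Frag A B (Fin 17) :=
  seq (decodeTo 7 9 10) <| seq (clear 10) <| seq (decodeTo 7 9 10) <| seq (decodeTo 7 9 11) <|
  seq cmpDigits <| seq (pop 12 fun o => push 8 (o.getD false)) <| seq (clear 12) <|
  seq (pop 13 fun o => if o.getD false then skip else push 14 true) <| seq (clear 13) (clear 10)

/-- The numerator read from the code `s` of an evidence frame. -/
def numWord (s : List Bool) : List Bool := (decodeWord (decodeWord s).2).1

/-- The denominator read from the code `s` of an evidence frame. -/
def denWord (s : List Bool) : List Bool := (decodeWord (decodeWord (decodeWord s).2).2).1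

/-- The code of the rest of an evidence frame. -/
def restWord (s : List Bool) : List Bool := (decodeWord (decodeWord (decodeWord s).2).2).2

/-- The result of the comparison of the first `n` digits of `y` with those of `a`. -/
def ltWord (n : ℕ) (y a : List Bool) : Bool := (cmpStack n y a []).head?.getD false

theorem length_restWord_lt {s : List Bool} (h : s ≠ []) :
    (restWord s).length < s.length := by
  have h1 := length_decodeWord_lt s h
  have h2 := length_decodeWord_le (decodeWord s).2
  have h3 := length_decodeWord_le (decodeWord (decodeWord s).2).2
  rw [restWord]
  omega

theorem runs_readEvidence (M : Regs) (h9 : M.r9 = []) (h10 : M.r10 = []) (h11 : M.r11 = [])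
    (h12 : M.r12 = []) (h13 : M.r13 = []) :
    Runs (readEvidence : Frag A B (Fin 17)) M.get
      {M with
        r2 := M.r2.drop (denWord M.r7).length
        r7 := restWord M.r7
        r8 := ltWord (denWord M.r7).length M.r2 (numWord M.r7) :: M.r8
        r14 := if ltWord (denWord M.r7).length M.r2 (denWord M.r7) then M.r14 else
          true :: M.r14}.get
      (40 * M.r7.length + 40) := by
  obtain ⟨r0, r1, y, r3, r4, r5, r6, s, bv, r9, r10, r11, r12, r13, rej, r15, r16⟩ := M
  dsimp only at h9 h10 h11 h12 h13
  subst h9 h10 h11 h12 h13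
  have h1 := length_decodeWord_le s
  have h2 := length_decodeWord_le (decodeWord s).2
  have h3 := length_decodeWord_le (decodeWord (decodeWord s).2).2
  have h4 := length_cmpStack_le (denWord s).length y (numWord s) []
  have h5 := length_cmpStack_le (denWord s).length y (denWord s) []
  let N : Regs := ⟨r0, r1, y, r3, r4, r5, r6, s, bv, [], [], [], [], [], rej, r15, r16⟩
  let N₅ : Regs := {N with
    r2 := y.drop (denWord s).length
    r7 := restWord s
    r10 := (numWord s).drop (denWord s).length
    r12 := cmpStack (denWord s).length y (numWord s) []
    r13 := cmpStack (denWord s).length y (denWord s) []}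
  let N₆ : Regs := {N₅ with r8 := ltWord (denWord s).length y (numWord s) :: bv}
  let N₈ : Regs := {N₆ with
    r12 := []
    r14 := if ltWord (denWord s).length y (denWord s) then rej else true :: rej}
  -- The bit vector of the piece of evidence is read and thrown away; only its degree matters for
  -- the guess.
  have s1 : Runs (decodeTo 7 9 10 : Frag A B (Fin 17)) N.get
      {N with r7 := (decodeWord s).2, r10 := (decodeWord s).1}.get (5 * s.length + 5) :=
    runs_decodeTo_of _ (by decide) (by decide) (by decide) rfl rfl rfl (by simp only [update_get])
  have s2 : Runs (clear 10 : Frag A B (Fin 17))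
      {N with r7 := (decodeWord s).2, r10 := (decodeWord s).1}.get
      {N with r7 := (decodeWord s).2}.get (2 * (decodeWord s).1.length + 1) :=
    runs_clear_of _ rfl (by simp only [update_get]; rfl)
  have s3 : Runs (decodeTo 7 9 10 : Frag A B (Fin 17)) {N with r7 := (decodeWord s).2}.get
      {N with r7 := (decodeWord (decodeWord s).2).2, r10 := numWord s}.get
      (5 * (decodeWord s).2.length + 5) :=
    runs_decodeTo_of _ (by decide) (by decide) (by decide) rfl rfl rfl
      (by simp only [update_get]; rfl)
  have s4 : Runs (decodeTo 7 9 11 : Frag A B (Fin 17))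
      {N with r7 := (decodeWord (decodeWord s).2).2, r10 := numWord s}.get
      {N with r7 := restWord s, r10 := numWord s, r11 := denWord s}.get
      (5 * (decodeWord (decodeWord s).2).2.length + 5) :=
    runs_decodeTo_of _ (by decide) (by decide) (by decide) rfl rfl rfl
      (by simp only [update_get]; rfl)
  have s5 : Runs (cmpDigits : Frag A B (Fin 17))
      {N with r7 := restWord s, r10 := numWord s, r11 := denWord s}.get N₅.get
      (5 * (denWord s).length + 1) := runs_cmpDigits _
  have s6 : Runs (pop 12 fun o => push 8 (o.getD false) : Frag A B (Fin 17)) N₅.get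
      {N₆ with r12 := (cmpStack (denWord s).length y (numWord s) []).tail}.get (1 + 1) :=
    (Runs.pop (runs_push _ _ _)).congr rfl (by simp only [update_get]; rfl) le_rfl
  have s7 : Runs (clear 12 : Frag A B (Fin 17))
      {N₆ with r12 := (cmpStack (denWord s).length y (numWord s) []).tail}.get
      {N₆ with r12 := []}.get
      (2 * (cmpStack (denWord s).length y (numWord s) []).tail.length + 1) :=
    runs_clear_of _ rfl (by simp only [update_get])
  have s8 : Runs (pop 13 fun o => if o.getD false then skip else push 14 true :
      Frag A B (Fin 17)) {N₆ with r12 := []}.get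
      {N₈ with r13 := (cmpStack (denWord s).length y (denWord s) []).tail}.get (1 + 1) := by
    refine Runs.pop ?_
    simp only [update_get]
    change Runs (if ltWord (denWord s).length y (denWord s) then skip else push 14 true) _ _ _
    by_cases h : ltWord (denWord s).length y (denWord s) = true
    · simp only [N₈, h, if_true]
      exact runs_skip _
    · simp only [N₈, h]
      exact (runs_push _ _ _).congr rfl (by simp only [update_get]; rfl) le_rfl
  have s9 : Runs (clear 13 : Frag A B (Fin 17))
      {N₈ with r13 := (cmpStack (denWord s).length y (denWord s) []).tail}.get
      {N₈ with r13 := []}.get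
      (2 * (cmpStack (denWord s).length y (denWord s) []).tail.length + 1) :=
    runs_clear_of _ rfl (by simp only [update_get])
  have s10 : Runs (clear 10 : Frag A B (Fin 17)) {N₈ with r13 := []}.get
      {N₈ with r10 := [], r13 := []}.get
      (2 * ((numWord s).drop (denWord s).length).length + 1) :=
    runs_clear_of _ rfl (by simp only [update_get])
  refine (s1.seq <| s2.seq <| s3.seq <| s4.seq <| s5.seq <| s6.seq <| s7.seq <| s8.seq <|
    s9.seq s10).congr rfl rfl ?_
  have e1 : (numWord s).length = (decodeWord (decodeWord s).2).1.length := rfl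
  have e2 : (denWord s).length = (decodeWord (decodeWord (decodeWord s).2).2).1.length := rfl
  simp only [List.length_tail, List.length_drop, List.length_nil] at *
  omega

/-- The digits left, the results of the comparisons, and the marks, after all entries of an evidence
frame with the code `s` have been processed. -/
def readAll (s y bv rej : List Bool) : List Bool × List Bool × List Bool :=
  if h : s = [] then (y, bv, rej) else
    have := length_restWord_lt h
    readAll (restWord s) (y.drop (denWord s).length)
      (ltWord (denWord s).length y (numWord s) :: bv)
      (if ltWord (denWord s).length y (denWord s) then rej else true :: rej)
termination_by s.length

theorem length_readAll_le (s y bv rej : List Bool) :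
    (readAll s y bv rej).1.length ≤ y.length ∧
    (readAll s y bv rej).2.1.length ≤ bv.length + s.length ∧
    (readAll s y bv rej).2.2.length ≤ rej.length + s.length := by
  induction s, y, bv, rej using readAll.induct with
  | case1 y bv rej => rw [readAll]; simp
  | case2 s y bv rej hs h1 ih =>
    rw [readAll, dif_neg hs]
    simp only [List.length_cons, List.length_drop, dite_eq_ite] at ih ⊢
    have : (if ltWord (denWord s).length y (denWord s) then rej else true :: rej).length ≤
      rej.length + 1 := by split_ifs <;> simp
    omega

/-- An entry costs linear time and uses up at least one letter, hence the quadratic bound; as it may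
use up many, the induction is strong. -/
theorem runs_readAll (M : Regs) (h9 : M.r9 = []) (h10 : M.r10 = []) (h11 : M.r11 = [])
    (h12 : M.r12 = []) (h13 : M.r13 = []) :
    Runs (forEach 7 fun b => seq (push 7 b) readEvidence : Frag A B (Fin 17)) M.get
      {M with
        r2 := (readAll M.r7 M.r2 M.r8 M.r14).1
        r7 := []
        r8 := (readAll M.r7 M.r2 M.r8 M.r14).2.1
        r14 := (readAll M.r7 M.r2 M.r8 M.r14).2.2}.get
      (43 * (M.r7.length + 1) ^ 2) := by
  generalize hn : M.r7.length = n
  induction n using Nat.strong_induction_on generalizing M with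
  | _ n ih =>
    rcases hs : M.r7 with _ | ⟨b, s⟩
    · refine (runs_forEach_nil (S := M.get) (r := 7) hs).congr rfl ?_ (by nlinarith)
      rw [readAll, dif_pos rfl, ← hs]
    · have hne : M.r7 ≠ [] := by simp [hs]
      have hlt := length_restWord_lt hne
      let M' : Regs :=
        {M with
          r2 := M.r2.drop (denWord M.r7).length
          r7 := restWord M.r7
          r8 := ltWord (denWord M.r7).length M.r2 (numWord M.r7) :: M.r8
          r14 := if ltWord (denWord M.r7).length M.r2 (denWord M.r7) then M.r14 else
            true :: M.r14}
      -- The popped letter is put back at once: the pop of the loop only tests whether entries are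
      -- left.
      have hb : Runs (seq (push 7 b) readEvidence : Frag A B (Fin 17)) (update M.get 7 s)
        M'.get (1 + (40 * M.r7.length + 40)) := by
        refine ((runs_push _ _ _).congr rfl ?_ le_rfl).seq (runs_readEvidence M h9 h10 h11 h12 h13)
        rw [update_self, update_idem, ← hs]
        exact update_eq_self 7 M.get
      refine (Runs.forEach_cons (S := M.get) (r := 7) hs hb
        (ih _ (hn ▸ hlt) M' h9 h10 h11 h12 h13 rfl)).congr rfl ?_ ?_
      · simp only [← hs]
        rw [readAll.eq_1 M.r7, dif_neg hne]
      · change _ + 43 * ((restWord M.r7).length + 1) ^ 2 + 1 ≤ _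
        rw [← hn]
        have : (restWord M.r7).length + 1 ≤ M.r7.length := hlt
        have := Nat.pow_le_pow_left this 2
        nlinarith

/-! ### The verifier -/

/-- The marks set by the test whether `T` is contained in `P`. The test is void if `useP` is
`false`. -/
def excessStack (useP : Bool) : List Bool → List Bool → List Bool → List Bool
  | [], _, l => l
  | p :: P, T, l => excessStack useP P T.tail
      (if useP && T.head?.getD false && !p then true :: l else l)

theorem length_excessStack_le (useP : Bool) (P T l : List Bool) :
    (excessStack useP P T l).length ≤ l.length + P.length := by
  induction P generalizing T l with
  | nil => simp [excessStack]
  | cons p P ih =>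
    refine (ih _ _).trans ?_
    split_ifs <;> simp; omega

/-- Test whether the set in register 16 is contained in the one in register 6. -/
def checkSubset (useP : Bool) : Frag A B (Fin 17) :=
  forEach 6 fun p => pop 16 fun o =>
    if useP && o.getD false && !p then push 14 true else skip

theorem runs_checkSubset (useP : Bool) (M : Regs) :
    Runs (checkSubset useP : Frag A B (Fin 17)) M.get
      {M with
        r6 := []
        r14 := excessStack useP M.r6 M.r16 M.r14
        r16 := M.r16.drop M.r6.length}.get (3 * M.r6.length + 1) := by
  generalize hP : M.r6 = P
  induction P generalizing M with
  | nil =>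
    refine (runs_forEach_nil (S := M.get) (r := 6) hP).congr rfl ?_ (by simp)
    conv_lhs => rw [show M = {M with r6 := []} by rw [← hP]]
    rfl
  | cons p P ih =>
    let M' : Regs := {M with
      r6 := P
      r14 := if useP && M.r16.head?.getD false && !p then true :: M.r14 else M.r14
      r16 := M.r16.tail}
    have hb : Runs (pop 16 fun o => if useP && o.getD false && !p then push 14 true else skip :
        Frag A B (Fin 17)) (update M.get 6 P) M'.get 2 := by
      refine Runs.pop (t := 1) ?_
      simp only [update_get]
      change Runs (if useP && M.r16.head?.getD false && !p then push 14 true else skip) _ _ _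
      by_cases h : (useP && M.r16.head?.getD false && !p) = true
      · simp only [M', h, if_true]
        exact (runs_push _ _ _).congr rfl (by simp only [update_get]; rfl) le_rfl
      · simp only [M', h]
        exact runs_skip _
    refine (Runs.forEach_cons (S := M.get) (r := 6) hP hb (ih M' rfl)).congr rfl ?_ ?_
    · simp [M', excessStack]
    · simp; omega

/-- Split the input into its components. -/
def parseInput : Frag A B (Fin 17) :=
  seq (decodeTo 0 9 1) <| seq (decodeTo 0 9 2) <| seq (clear 0) <| seq (decodeTo 1 9 3) <|
  seq (decodeTo 1 9 4) <| seq (decodeTo 1 9 5) <| seq (decodeTo 1 9 6) (clear 1)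

/-- The empty registers. -/
def Regs.empty : Regs := ⟨[], [], [], [], [], [], [], [], [], [], [], [], [], [], [], [], []⟩

/-- The random digits. -/
def digitsOf (z : List Bool) : List Bool := (decodeWord (decodeWord z).2).1
/-- The evidence frame. -/
def frameOf (z : List Bool) : List Bool := (decodeWord (decodeWord z).1).1
/-- The description of the frame of justification. -/
def specJOf (z : List Bool) : List Bool := (decodeWord (decodeWord (decodeWord z).1).2).1
/-- The description of the allocation function. -/
def specFOf (z : List Bool) : List Bool :=
  (decodeWord (decodeWord (decodeWord (decodeWord z).1).2).2).1
/-- The proposition. -/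
def propOf (z : List Bool) : List Bool :=
  (decodeWord (decodeWord (decodeWord (decodeWord (decodeWord z).1).2).2).2).1

theorem length_components_le (z : List Bool) :
    (digitsOf z).length ≤ z.length ∧
    (frameOf z).length + (specJOf z).length + (specFOf z).length + (propOf z).length
      ≤ z.length := by
  have h1 := length_decodeWord_le z
  have h2 := length_decodeWord_le (decodeWord z).2
  have h3 := length_decodeWord_le (decodeWord z).1
  have h4 := length_decodeWord_le (decodeWord (decodeWord z).1).2
  have h5 := length_decodeWord_le (decodeWord (decodeWord (decodeWord z).1).2).2
  have h6 := length_decodeWord_le (decodeWord (decodeWord (decodeWord (decodeWord z).1).2).2).2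
  unfold digitsOf frameOf specJOf specFOf propOf
  omega

theorem runs_parseInput (z : List Bool) :
    Runs (parseInput : Frag A B (Fin 17)) {Regs.empty with r0 := z}.get
      {Regs.empty with
        r2 := digitsOf z
        r3 := frameOf z
        r4 := specJOf z
        r5 := specFOf z
        r6 := propOf z}.get (50 * z.length + 50) := by
  have h1 := length_decodeWord_le z
  have h2 := length_decodeWord_le (decodeWord z).2
  have h3 := length_decodeWord_le (decodeWord z).1
  have h4 := length_decodeWord_le (decodeWord (decodeWord z).1).2
  have h5 := length_decodeWord_le (decodeWord (decodeWord (decodeWord z).1).2).2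
  have h6 := length_decodeWord_le (decodeWord (decodeWord (decodeWord (decodeWord z).1).2).2).2
  let N : Regs := {Regs.empty with r2 := digitsOf z}
  have s1 : Runs (decodeTo 0 9 1 : Frag A B (Fin 17)) {Regs.empty with r0 := z}.get
      {Regs.empty with r0 := (decodeWord z).2, r1 := (decodeWord z).1}.get _ :=
    runs_decodeTo_of z (by decide) (by decide) (by decide) rfl rfl rfl
      (by simp only [update_get])
  have s2 : Runs (decodeTo 0 9 2 : Frag A B (Fin 17))
      {Regs.empty with r0 := (decodeWord z).2, r1 := (decodeWord z).1}.get
      {N with r0 := (decodeWord (decodeWord z).2).2, r1 := (decodeWord z).1}.get _ :=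
    runs_decodeTo_of (decodeWord z).2 (by decide) (by decide) (by decide) rfl rfl rfl
      (by simp only [update_get]; rfl)
  have s3 : Runs (clear 0 : Frag A B (Fin 17))
      {N with r0 := (decodeWord (decodeWord z).2).2, r1 := (decodeWord z).1}.get
      {N with r1 := (decodeWord z).1}.get _ :=
    runs_clear_of (decodeWord (decodeWord z).2).2 rfl (by simp only [update_get]; rfl)
  have s4 : Runs (decodeTo 1 9 3 : Frag A B (Fin 17)) {N with r1 := (decodeWord z).1}.get
      {N with r1 := (decodeWord (decodeWord z).1).2, r3 := frameOf z}.get _ :=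
    runs_decodeTo_of (decodeWord z).1 (by decide) (by decide) (by decide) rfl rfl rfl
      (by simp only [update_get]; rfl)
  have s5 : Runs (decodeTo 1 9 4 : Frag A B (Fin 17))
      {N with r1 := (decodeWord (decodeWord z).1).2, r3 := frameOf z}.get
      {N with r1 := (decodeWord (decodeWord (decodeWord z).1).2).2, r3 := frameOf z,
              r4 := specJOf z}.get _ :=
    runs_decodeTo_of (decodeWord (decodeWord z).1).2 (by decide) (by decide) (by decide) rfl rfl rfl
      (by simp only [update_get]; rfl)
  have s6 : Runs (decodeTo 1 9 5 : Frag A B (Fin 17))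
      {N with r1 := (decodeWord (decodeWord (decodeWord z).1).2).2, r3 := frameOf z,
              r4 := specJOf z}.get
      {N with r1 := (decodeWord (decodeWord (decodeWord (decodeWord z).1).2).2).2,
              r3 := frameOf z, r4 := specJOf z, r5 := specFOf z}.get _ :=
    runs_decodeTo_of (decodeWord (decodeWord (decodeWord z).1).2).2
      (by decide) (by decide) (by decide) rfl rfl rfl
      (by simp only [update_get]; rfl)
  have s7 : Runs (decodeTo 1 9 6 : Frag A B (Fin 17))
      {N with r1 := (decodeWord (decodeWord (decodeWord (decodeWord z).1).2).2).2,
              r3 := frameOf z, r4 := specJOf z, r5 := specFOf z}.get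
      {N with
        r1 := (decodeWord (decodeWord (decodeWord (decodeWord (decodeWord z).1).2).2).2).2,
        r3 := frameOf z, r4 := specJOf z, r5 := specFOf z, r6 := propOf z}.get _ :=
    runs_decodeTo_of (decodeWord (decodeWord (decodeWord (decodeWord z).1).2).2).2
      (by decide) (by decide) (by decide) rfl rfl rfl
      (by simp only [update_get]; rfl)
  have s8 : Runs (clear 1 : Frag A B (Fin 17))
      {N with
        r1 := (decodeWord (decodeWord (decodeWord (decodeWord (decodeWord z).1).2).2).2).2,
        r3 := frameOf z, r4 := specJOf z, r5 := specFOf z, r6 := propOf z}.get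
      {N with r3 := frameOf z, r4 := specJOf z, r5 := specFOf z, r6 := propOf z}.get _ :=
    runs_clear_of (decodeWord (decodeWord (decodeWord (decodeWord (decodeWord z).1).2).2).2).2
      rfl (by simp only [update_get]; rfl)
  refine (s1.seq <| s2.seq <| s3.seq <| s4.seq <| s5.seq <| s6.seq <| s7.seq s8).congr
    rfl rfl ?_
  omega

/-- Compute the set of pieces of evidence which corresponds to the random digits. -/
def guessEvidence : Frag A B (Fin 17) :=
  seq (encodeKeep 3 9 0) <| seq (move 0 1) <| seq (decodeTo 1 9 7) <| seq (decodeTo 7 9 10) <|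
  seq (clear 10) <| seq (forEach 7 fun b => seq (push 7 b) readEvidence) <| seq (clear 2) <|
  move 8 16

theorem length_encodeWord (w : List Bool) :
    (MultiLayerBelief.encodeWord w).length = 2 * w.length + 1 := by
  induction w with
  | nil => rfl
  | cons b w ih =>
    simp only [MultiLayerBelief.encodeWord, List.flatMap_cons, List.length_append,
      List.length_cons, List.length_nil] at ih ⊢
    omega

/-- The result of reading the digits `y` along the evidence frame `fr`. -/
def readFrame (fr y : List Bool) : List Bool × List Bool × List Bool :=
  readAll (decodeWord fr).2 y [] []

theorem runs_guessEvidence (M : Regs) (h0 : M.r0 = []) (h1 : M.r1 = []) (h7 : M.r7 = [])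
    (h8 : M.r8 = []) (h9 : M.r9 = []) (h10 : M.r10 = []) (h11 : M.r11 = []) (h12 : M.r12 = [])
    (h13 : M.r13 = []) (h14 : M.r14 = []) (h16 : M.r16 = []) :
    Runs (guessEvidence : Frag A B (Fin 17)) M.get
      {M with
        r2 := []
        r14 := (readFrame M.r3 M.r2).2.2
        r16 := (readFrame M.r3 M.r2).2.1.reverse}.get
      (43 * (M.r3.length + 1) ^ 2 + 50 * (M.r3.length + 1) + 2 * M.r2.length) := by
  obtain ⟨r0, r1, y, fr, r4, r5, r6, r7, r8, r9, r10, r11, r12, r13, r14, r15, r16⟩ := M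
  dsimp only at h0 h1 h7 h8 h9 h10 h11 h12 h13 h14 h16 ⊢
  subst h0 h1 h7 h8 h9 h10 h11 h12 h13 h14 h16
  let N : Regs := ⟨[], [], y, fr, r4, r5, r6, [], [], [], [], [], [], [], [], r15, []⟩
  let N₆ : Regs := {N with r14 := (readFrame fr y).2.2}
  -- Encoding, reversing and decoding copies register 3 to register 7. The original is kept for the
  -- arguments of both calls.
  have s1 : Runs (encodeKeep 3 9 0 : Frag A B (Fin 17)) N.get
      {N with r0 := (MultiLayerBelief.encodeWord fr).reverse}.get _ :=
    runs_encodeKeep_of fr [] (by decide) (by decide) (by decide) rfl rfl rfl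
      (by simp only [update_get, List.append_nil])
  have s2 : Runs (move 0 1 : Frag A B (Fin 17))
      {N with r0 := (MultiLayerBelief.encodeWord fr).reverse}.get
      {N with r1 := MultiLayerBelief.encodeWord fr}.get _ :=
    runs_move_of (MultiLayerBelief.encodeWord fr).reverse (by decide) rfl rfl
      (by simp only [update_get, List.reverse_reverse]; rfl)
  have hd := decodeWord_encodeWord fr []
  rw [List.append_nil] at hd
  have s3 : Runs (decodeTo 1 9 7 : Frag A B (Fin 17))
      {N with r1 := MultiLayerBelief.encodeWord fr}.get
      {N with r7 := fr}.get _ :=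
    runs_decodeTo_of (MultiLayerBelief.encodeWord fr) (by decide) (by decide) (by decide)
      rfl rfl rfl (by simp only [update_get, hd]; rfl)
  have s4 : Runs (decodeTo 7 9 10 : Frag A B (Fin 17)) {N with r7 := fr}.get
      {N with r7 := (decodeWord fr).2, r10 := (decodeWord fr).1}.get _ :=
    runs_decodeTo_of fr (by decide) (by decide) (by decide) rfl rfl rfl
      (by simp only [update_get])
  have s5 : Runs (clear 10 : Frag A B (Fin 17))
      {N with r7 := (decodeWord fr).2, r10 := (decodeWord fr).1}.get
      {N with r7 := (decodeWord fr).2}.get _ :=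
    runs_clear_of (decodeWord fr).1 rfl (by simp only [update_get]; rfl)
  have s6 : Runs (forEach 7 fun b => seq (push 7 b) readEvidence : Frag A B (Fin 17))
      {N with r7 := (decodeWord fr).2}.get
      {N₆ with r2 := (readFrame fr y).1, r8 := (readFrame fr y).2.1}.get _ :=
    runs_readAll {N with r7 := (decodeWord fr).2} rfl rfl rfl rfl rfl
  have s7 : Runs (clear 2 : Frag A B (Fin 17))
      {N₆ with r2 := (readFrame fr y).1, r8 := (readFrame fr y).2.1}.get
      {N₆ with r2 := [], r8 := (readFrame fr y).2.1}.get _ :=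
    runs_clear_of (readFrame fr y).1 rfl (by simp only [update_get])
  -- The truth values were stacked with the last one on top; moving them restores the order of the
  -- evidence list.
  have s8 : Runs (move 8 16 : Frag A B (Fin 17))
      {N₆ with r2 := [], r8 := (readFrame fr y).2.1}.get
      {N₆ with r2 := [], r16 := (readFrame fr y).2.1.reverse}.get _ :=
    runs_move_of (readFrame fr y).2.1 (by decide) rfl rfl (by simp only [update_get]; rfl)
  refine (s1.seq <| s2.seq <| s3.seq <| s4.seq <| s5.seq <| s6.seq <| s7.seq s8).congr
    rfl rfl ?_
  have l1 := length_decodeWord_le fr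
  have l2 := length_readAll_le (decodeWord fr).2 y [] []
  rw [← readFrame] at l2
  simp only [List.length_reverse, length_encodeWord, List.length_nil] at l2 ⊢
  have l3 : ((decodeWord fr).2.length + 1) ^ 2 ≤ (fr.length + 1) ^ 2 :=
    Nat.pow_le_pow_left (by omega) 2
  omega

/-- Apply the function computed by `M` to the sequence of the words in the registers `a`, 3 and 16,
with the result in reversed order in register 1. -/
def applyTo (M : Callee A B (Fin 17)) (a : Fin 17) : Frag A B (Fin 17) :=
  seq (encodeKeep a 9 0) <| seq (encodeKeep 3 9 0) <| seq (encodeKeep 16 9 0) (call M 0 1)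

theorem reverse_encodeTuple (u v w : List Bool) :
    (MultiLayerBelief.encodeTuple [u, v, w]).reverse =
      (MultiLayerBelief.encodeWord w).reverse ++ ((MultiLayerBelief.encodeWord v).reverse ++
        (MultiLayerBelief.encodeWord u).reverse) := by
  simp [MultiLayerBelief.encodeTuple]

theorem length_encodeTuple (u v w : List Bool) :
    (MultiLayerBelief.encodeTuple [u, v, w]).length =
      2 * (u.length + v.length + w.length) + 3 := by
  simp [MultiLayerBelief.encodeTuple, length_encodeWord]; omega

/-- Here `t` is any bound for the length of the coded triple, so that the time can be expressed by
the input length; `eval_mono` passes from the true length to `t`. -/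
theorem runs_applyTo (C : Callee A B (Fin 17)) {f : List Bool → List Bool} {p : Polynomial ℕ}
    (hC : C.Computes f p) (a : Fin 17) (ha9 : a ≠ 9) (ha0 : a ≠ 0) (M : Regs) (h0 : M.r0 = [])
    (h1 : M.r1 = []) (h9 : M.r9 = []) (w : List Bool) (haw : M.get a = w) (t : ℕ)
    (ht : 2 * (w.length + M.r3.length + M.r16.length) + 3 ≤ t) :
    Runs (applyTo C a) M.get
      {M with r1 := (f (MultiLayerBelief.encodeTuple [w, M.r3, M.r16])).reverse}.get
      (5 * t + 2 * p.eval t) := by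
  obtain ⟨r0, r1, y, fr, r4, r5, r6, r7, r8, r9, r10, r11, r12, r13, r14, r15, r16⟩ := M
  dsimp only at h0 h1 h9 ht ⊢
  subst h0 h1 h9
  let N : Regs := ⟨[], [], y, fr, r4, r5, r6, r7, r8, [], r10, r11, r12, r13, r14, r15, r16⟩
  have s1 : Runs (encodeKeep a 9 0 : Frag A B (Fin 17)) N.get
      {N with r0 := (MultiLayerBelief.encodeWord w).reverse}.get _ :=
    runs_encodeKeep_of w [] ha9 ha0 (by decide) haw rfl rfl
      (by simp only [update_get, List.append_nil])
  have s2 : Runs (encodeKeep 3 9 0 : Frag A B (Fin 17))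
      {N with r0 := (MultiLayerBelief.encodeWord w).reverse}.get
      {N with r0 := (MultiLayerBelief.encodeWord fr).reverse ++
        (MultiLayerBelief.encodeWord w).reverse}.get _ :=
    runs_encodeKeep_of fr (MultiLayerBelief.encodeWord w).reverse
      (by decide) (by decide) (by decide) rfl rfl rfl
      (by simp only [update_get])
  have s3 : Runs (encodeKeep 16 9 0 : Frag A B (Fin 17))
      {N with r0 := (MultiLayerBelief.encodeWord fr).reverse ++
        (MultiLayerBelief.encodeWord w).reverse}.get
      {N with r0 := (MultiLayerBelief.encodeTuple [w, fr, r16]).reverse}.get _ :=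
    runs_encodeKeep_of r16 ((MultiLayerBelief.encodeWord fr).reverse ++
        (MultiLayerBelief.encodeWord w).reverse) (by decide) (by decide) (by decide) rfl rfl rfl
      (by simp only [update_get, reverse_encodeTuple])
  have s4 : Runs (call C 0 1)
      {N with r0 := (MultiLayerBelief.encodeTuple [w, fr, r16]).reverse}.get
      {N with r1 := (f (MultiLayerBelief.encodeTuple [w, fr, r16])).reverse}.get _ :=
    runs_call_of C (by decide) (hC _).1 rfl rfl (by simp only [update_get]; rfl)
  refine (s1.seq <| s2.seq <| s3.seq s4).congr rfl rfl ?_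
  have l1 := (hC (MultiLayerBelief.encodeTuple [w, fr, r16])).2
  have l2 := eval_mono p (a := (MultiLayerBelief.encodeTuple [w, fr, r16]).length) (b := t)
    (by rw [length_encodeTuple]; omega)
  rw [length_encodeTuple] at *
  dsimp only [N] at *
  omega

/-- The program of the verifier. -/
def verifier (useP : Bool) (F J : Callee A B (Fin 17)) : Frag A B (Fin 17) :=
  seq parseInput <| seq guessEvidence <| seq (applyTo F 5) <| seq (clear 16) <| seq (move 1 16) <|
  seq (applyTo J 4) <| seq (checkSubset useP) <|
  seq (pop 1 fun o => pop 14 fun r => push 15 (o.getD false && r.isNone)) <|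
  seq (clear 1) <| seq (clear 3) <| seq (clear 4) <| seq (clear 5) <| seq (clear 14) (clear 16)

/-- The set assigned to the evidence guessed by the digits. -/
def guessedSet (F : List Bool → List Bool) (z : List Bool) : List Bool :=
  F (MultiLayerBelief.encodeTuple
    [specFOf z, frameOf z, (readFrame (frameOf z) (digitsOf z)).2.1.reverse])

/-- The relation decided by the verifier. -/
def accept (useP : Bool) (F : List Bool → List Bool) (J : List Bool → Bool) (z : List Bool) :
    Bool :=
  J (MultiLayerBelief.encodeTuple [specJOf z, frameOf z, guessedSet F z]) &&
    (excessStack useP (propOf z) (guessedSet F z)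
      (readFrame (frameOf z) (digitsOf z)).2.2).head?.isNone

/-- The arguments of `6 * z.length + 3` and `4 * z.length + 2 * t + 3` are generous bounds for the
coded arguments of the two calls. The output of the first call, of length at most `t`, is part of
the argument of the second. -/
theorem runs_verifier (useP : Bool) (CF CJ : Callee A B (Fin 17)) {F : List Bool → List Bool}
    {J : List Bool → Bool} {pF pJ : Polynomial ℕ} (hF : CF.Computes F pF)
    (hJ : CJ.Computes (fun w => [J w]) pJ) (z : List Bool) (t t' : ℕ)
    (ht : t = pF.eval (6 * z.length + 3)) (ht' : t' = pJ.eval (4 * z.length + 2 * t + 3)) :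
    Runs (verifier useP CF CJ) {Regs.empty with r0 := z}.get
      {Regs.empty with r15 := [accept useP F J z]}.get
      (1000 * (z.length + 1) ^ 2 + 20 * t + 2 * t') := by
  obtain ⟨l1, l2⟩ := length_components_le z
  have l3 := length_readAll_le (decodeWord (frameOf z)).2 (digitsOf z) [] []
  rw [← readFrame] at l3
  simp only [List.length_nil, zero_add] at l3
  have l4 := length_decodeWord_le (frameOf z)
  have l5 : (guessedSet F z).length ≤ t := by
    refine ((hF _).2.trans (eval_mono pF ?_)).trans ht.ge
    rw [length_encodeTuple, List.length_reverse]
    omega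
  let bv := (readFrame (frameOf z) (digitsOf z)).2.1
  let rej := (readFrame (frameOf z) (digitsOf z)).2.2
  let T := guessedSet F z
  let r := J (MultiLayerBelief.encodeTuple [specJOf z, frameOf z, T])
  let e := excessStack useP (propOf z) T rej
  let N : Regs := {Regs.empty with r3 := frameOf z, r4 := specJOf z, r5 := specFOf z}
  let Q : Regs := {Regs.empty with
    r14 := e.tail
    r15 := [accept useP F J z]
    r16 := T.drop (propOf z).length}
  have s1 : Runs (parseInput : Frag A B (Fin 17)) {Regs.empty with r0 := z}.get
      {N with r2 := digitsOf z, r6 := propOf z}.get _ := runs_parseInput z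
  have s2 : Runs (guessEvidence : Frag A B (Fin 17))
      {N with r2 := digitsOf z, r6 := propOf z}.get
      {N with r6 := propOf z, r14 := rej, r16 := bv.reverse}.get _ :=
    runs_guessEvidence {N with r2 := digitsOf z, r6 := propOf z}
      rfl rfl rfl rfl rfl rfl rfl rfl rfl rfl rfl
  have s3 : Runs (applyTo CF 5) {N with r6 := propOf z, r14 := rej, r16 := bv.reverse}.get
      {N with r1 := T.reverse, r6 := propOf z, r14 := rej, r16 := bv.reverse}.get
      (5 * (6 * z.length + 3) + 2 * t) := by
    rw [ht]
    refine runs_applyTo CF hF 5 (by decide) (by decide)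
      {N with r6 := propOf z, r14 := rej, r16 := bv.reverse} rfl rfl rfl (specFOf z) rfl _ ?_
    dsimp only [N, bv]
    rw [List.length_reverse]
    omega
  have s4 : Runs (clear 16 : Frag A B (Fin 17))
      {N with r1 := T.reverse, r6 := propOf z, r14 := rej, r16 := bv.reverse}.get
      {N with r1 := T.reverse, r6 := propOf z, r14 := rej}.get _ :=
    runs_clear_of bv.reverse rfl (by simp only [update_get]; rfl)
  have s5 : Runs (move 1 16 : Frag A B (Fin 17))
      {N with r1 := T.reverse, r6 := propOf z, r14 := rej}.get
      {N with r6 := propOf z, r14 := rej, r16 := T}.get _ :=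
    runs_move_of T.reverse (by decide)
      rfl rfl (by simp only [update_get, List.reverse_reverse]; rfl)
  have s6 : Runs (applyTo CJ 4) {N with r6 := propOf z, r14 := rej, r16 := T}.get
      {N with r1 := [r], r6 := propOf z, r14 := rej, r16 := T}.get
      (5 * (4 * z.length + 2 * t + 3) + 2 * t') := by
    rw [ht']
    refine runs_applyTo CJ hJ 4 (by decide) (by decide)
      {N with r6 := propOf z, r14 := rej, r16 := T} rfl rfl rfl (specJOf z) rfl _ ?_
    dsimp only [N, T]
    omega
  have s7 : Runs (checkSubset useP : Frag A B (Fin 17))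
      {N with r1 := [r], r6 := propOf z, r14 := rej, r16 := T}.get
      {N with r1 := [r], r14 := e, r16 := T.drop (propOf z).length}.get _ :=
    runs_checkSubset useP {N with r1 := [r], r6 := propOf z, r14 := rej, r16 := T}
  -- A single mark in register 14 leads to rejection, whether it comes from a block out of range or
  -- from the subset test.
  have s8 : Runs (pop 1 fun o => pop 14 fun r => push 15 (o.getD false && r.isNone) :
      Frag A B (Fin 17)) {N with r1 := [r], r14 := e, r16 := T.drop (propOf z).length}.get
      {Q with r3 := frameOf z, r4 := specJOf z, r5 := specFOf z}.get (1 + 1 + 1) :=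
    (Runs.pop (Runs.pop (runs_push _ _ _))).congr rfl (by simp only [update_get]; rfl) le_rfl
  -- From here on only cleaning: a machine must halt with all stacks except the output empty.
  have s9 : Runs (clear 1 : Frag A B (Fin 17))
      {Q with r3 := frameOf z, r4 := specJOf z, r5 := specFOf z}.get
      {Q with r3 := frameOf z, r4 := specJOf z, r5 := specFOf z}.get _ :=
    runs_clear_of [] rfl (by simp only [update_get]; rfl)
  have s10 : Runs (clear 3 : Frag A B (Fin 17))
      {Q with r3 := frameOf z, r4 := specJOf z, r5 := specFOf z}.get
      {Q with r4 := specJOf z, r5 := specFOf z}.get _ :=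
    runs_clear_of (frameOf z) rfl (by simp only [update_get]; rfl)
  have s11 : Runs (clear 4 : Frag A B (Fin 17)) {Q with r4 := specJOf z, r5 := specFOf z}.get
      {Q with r5 := specFOf z}.get _ :=
    runs_clear_of (specJOf z) rfl (by simp only [update_get]; rfl)
  have s12 : Runs (clear 5 : Frag A B (Fin 17)) {Q with r5 := specFOf z}.get Q.get _ :=
    runs_clear_of (specFOf z) rfl (by simp only [update_get]; rfl)
  have s13 : Runs (clear 14 : Frag A B (Fin 17)) Q.get {Q with r14 := []}.get _ :=
    runs_clear_of e.tail rfl (by simp only [update_get])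
  have s14 : Runs (clear 16 : Frag A B (Fin 17)) {Q with r14 := []}.get
      {Regs.empty with r15 := [accept useP F J z]}.get _ :=
    runs_clear_of (T.drop (propOf z).length) rfl (by simp only [update_get]; rfl)
  refine (s1.seq <| s2.seq <| s3.seq <| s4.seq <| s5.seq <| s6.seq <| s7.seq <| s8.seq <|
    s9.seq <| s10.seq <| s11.seq <| s12.seq <| s13.seq s14).congr rfl rfl ?_
  have l6 : e.length ≤ rej.length + (propOf z).length := length_excessStack_le _ _ _ _
  have l7 : bv.length ≤ z.length := by dsimp only [bv]; omega
  have l8 : rej.length ≤ z.length := by dsimp only [rej]; omega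
  have l9 : T.length ≤ t := l5
  have l10 : ((frameOf z).length + 1) ^ 2 ≤ (z.length + 1) ^ 2 :=
    Nat.pow_le_pow_left (by omega) 2
  have l11 : (z.length + 1) ≤ (z.length + 1) ^ 2 := Nat.le_self_pow (by norm_num) _
  dsimp only [N, Regs.empty] at *
  simp only [List.length_reverse, List.length_drop, List.length_tail, List.length_nil] at *
  omega

theorem polyTimeDecidable_accept (useP : Bool) {F : List Bool → List Bool} {J : List Bool → Bool}
    (hF : MultiLayerBelief.PolyTimeComputable F) (hJ : MultiLayerBelief.PolyTimeDecidable J) :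
    MultiLayerBelief.PolyTimeDecidable (accept useP F J) := by
  obtain ⟨hF⟩ := hF
  obtain ⟨hJ⟩ := hJ
  obtain ⟨pF, hpF⟩ := exists_computes_calleeA (R := Fin 17) hF hJ.tm
  obtain ⟨pJ, hpJ⟩ := exists_computes_calleeB (R := Fin 17) hJ hF.tm
  let := hF.tm.kFin
  let := hJ.tm.kFin
  let := hF.tm.σFin
  let := hJ.tm.σFin
  let tF : Polynomial ℕ := pF.comp (6 * Polynomial.X + 3)
  refine polyTime_of_runs (A := hF.tm) (B := hJ.tm) (R := Fin 17)
    (p := verifier useP (calleeA hF.tm hJ.tm (Fin 17) hF.inputAlphabet hF.outputAlphabet)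
      (calleeB hF.tm hJ.tm (Fin 17) hJ.inputAlphabet hJ.outputAlphabet)) (i := 0) (o := 15)
    (1000 * (Polynomial.X + 1) ^ 2 + 20 * tF + 2 * pJ.comp (4 * Polynomial.X + 2 * tF + 3))
    fun z => ?_
  refine (runs_verifier useP _ _ hpF hpJ z _ _ rfl rfl).congr ?_ ?_ ?_
  · funext k; fin_cases k <;> rfl
  · funext k; fin_cases k <;> rfl
  · simp [tF]

open MultiLayerBelief

/-! ### Comparison of numbers -/

/-- The number whose binary digits are the first `n` letters of a word, the least significant digit
first. -/
def natVal : ℕ → List Bool → ℕ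
  | 0, _ => 0
  | n + 1, y => (y.head?.getD false).toNat + 2 * natVal n y.tail

/-- The most significant position where two numbers differ decides their order, and the larger
number has digit 1 there. Least significant digits come first, so the digit recorded last, on top of
the stack, is the decisive one. -/
theorem head_cmpStack (n : ℕ) (y a l : List Bool) :
    (cmpStack n y a l).head?.getD false =
      if natVal n y = natVal n a then l.head?.getD false else decide (natVal n y < natVal n a) := by
  induction n generalizing y a l with
  | zero => simp [cmpStack, natVal]
  | succ n ih =>
    -- Here `u`, `v` are the values of the higher digits, `b`, `c` the lowest digits, and `s` is the
    -- answer if the numbers agree.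
    have key : ∀ (u v : ℕ) (b c s : Bool), (if u = v then (if b = c then s else c) else
        decide (u < v)) = if b.toNat + 2 * u = c.toNat + 2 * v then s else
        decide (b.toNat + 2 * u < c.toNat + 2 * v) := by
      intro u v b c s
      rcases lt_trichotomy u v with h | h | h
      · rw [if_neg h.ne, if_neg (by cases b <;> cases c <;> simp <;> omega)]
        cases b <;> cases c <;> simp <;> omega
      · subst h
        cases b <;> cases c <;> simp
      · rw [if_neg h.ne', if_neg (by cases b <;> cases c <;> simp <;> omega)]
        cases b <;> cases c <;> simp <;> omega
    have h : (if y.head?.getD false = a.head?.getD false then l else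
        a.head?.getD false :: l).head?.getD false =
        if y.head?.getD false = a.head?.getD false then l.head?.getD false else
        a.head?.getD false := by split_ifs <;> rfl
    rw [cmpStack, ih, h]
    exact key _ _ _ _ _

theorem ltWord_eq (n : ℕ) (y a : List Bool) :
    ltWord n y a = decide (natVal n y < natVal n a) := by
  rw [ltWord, head_cmpStack]
  split_ifs with h
  · simp [h]
  · rfl

theorem natVal_bits (n a : ℕ) (h : a < 2 ^ n) : natVal n a.bits = a := by
  induction n generalizing a with
  | zero => simp at h; simp [h, natVal]
  | succ n ih =>
    have h2 : a.div2 < 2 ^ n := by rw [Nat.div2_val]; omega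
    rw [natVal, ← Nat.div2_bits_eq_tail, ih _ h2]
    have h3 : a.bits.head?.getD false = a.bodd := by
      rw [Nat.bodd_eq_bits_head]; cases a.bits <;> rfl
    rw [h3]
    have := Nat.bodd_add_div2 a
    cases hb : a.bodd <;> simp [hb] at this ⊢ <;> omega

theorem lt_two_pow_length_bits (d : ℕ) : d < 2 ^ d.bits.length := by
  rw [Nat.size_eq_bits_len]; exact Nat.lt_size_self d

/-! ### Counting words -/

/-- The number of words of length `n` which satisfy `p`. -/
def countWords : ℕ → (List Bool → Bool) → ℕ
  | 0, p => (p []).toNat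
  | n + 1, p => countWords n (fun y => p (false :: y)) + countWords n (fun y => p (true :: y))

/-- Prepend a letter to the words of length `n`. -/
def consEmbedding (n : ℕ) (b : Bool) : List.Vector Bool n ↪ List.Vector Bool (n + 1) where
  toFun y := b ::ᵥ y
  inj' x y h := by simpa using congrArg List.Vector.tail h

theorem consEmbedding_apply (n : ℕ) (b : Bool) (y : List.Vector Bool n) :
    consEmbedding n b y = b ::ᵥ y := rfl

/-- Splitting by the first letter turns the cardinality into a recursion that runs parallel to the
reading of digits. -/
theorem card_filter_eq_countWords (n : ℕ) (p : List Bool → Bool) :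
    (Finset.univ.filter fun y : List.Vector Bool n => p y.toList = true).card =
      countWords n p := by
  induction n generalizing p with
  | zero =>
    rw [countWords, Finset.filter_congr (q := fun _ => p [] = true)]
    · cases h : p [] <;> simp
    · intro y _; rw [y.eq_nil]; rfl
  | succ n ih =>
    have h : (Finset.univ.filter fun y : List.Vector Bool (n + 1) => p y.toList = true) =
        ((Finset.univ.filter fun y : List.Vector Bool n => p (false :: y.toList) = true).map
          (consEmbedding n false)) ∪
        ((Finset.univ.filter fun y : List.Vector Bool n => p (true :: y.toList) = true).map
          (consEmbedding n true)) := by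
      ext y
      simp only [Finset.mem_filter, Finset.mem_univ, true_and, Finset.mem_union,
        Finset.mem_map, consEmbedding_apply]
      constructor
      · intro hy
        rw [← y.cons_head_tail, List.Vector.toList_cons] at hy
        cases hh : y.head
        · exact .inl ⟨y.tail, by rwa [hh] at hy, by rw [← hh, y.cons_head_tail]⟩
        · exact .inr ⟨y.tail, by rwa [hh] at hy, by rw [← hh, y.cons_head_tail]⟩
      · rintro (⟨a, ha, rfl⟩ | ⟨a, ha, rfl⟩) <;> simpa using ha
    rw [h, Finset.card_union_of_disjoint, Finset.card_map, Finset.card_map, countWords,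
      ← ih, ← ih]
    rw [Finset.disjoint_left]
    intro y h1 h2
    obtain ⟨a, -, ha⟩ := Finset.mem_map.1 h1
    obtain ⟨b, -, hb⟩ := Finset.mem_map.1 h2
    have := congrArg List.Vector.head (ha.trans hb.symm)
    simp [consEmbedding_apply] at this

theorem countWords_const (n : ℕ) (b : Bool) : countWords n (fun _ => b) = 2 ^ n * b.toNat := by
  induction n with
  | zero => simp [countWords]
  | succ n ih => rw [countWords, ih, pow_succ]; ring

/-- Among the values of the first `l` digits, `a` lie below `a` and `d - a` lie in `[a, d)`; `hd`
ensures that all of these occur. The induction splits by parity, the first letter being the least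
significant digit. -/
theorem countWords_digits (l q a d : ℕ) (had : a ≤ d) (hd : d ≤ 2 ^ l)
    (G : Bool → List Bool → Bool) :
    countWords (l + q) (fun y => decide (natVal l y < d) &&
        G (decide (natVal l y < a)) (y.drop l)) =
      a * countWords q (G true) + (d - a) * countWords q (G false) := by
  induction l generalizing a d with
  | zero =>
    simp only [natVal, Nat.zero_add, List.drop_zero]
    rcases Nat.eq_zero_or_pos d with rfl | hd0
    · obtain rfl : a = 0 := by omega
      simp [countWords_const]
    · obtain rfl : d = 1 := by simp at hd; omega
      rcases Nat.eq_zero_or_pos a with rfl | ha0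
      · simp
      · obtain rfl : a = 1 := by omega
        simp
  | succ l ih =>
    rw [show l + 1 + q = (l + q) + 1 by ring, countWords]
    -- 2v < c means v < ⌈c/2⌉, and 2v + 1 < c means v < ⌊c/2⌋; the two halves add up to c.
    have h0 := ih ((a + 1) / 2) ((d + 1) / 2) (by omega) (by omega)
    have h1 := ih (a / 2) (d / 2) (by omega) (by omega)
    have e0 : ∀ y c, (natVal (l + 1) (false :: y) < c) = (natVal l y < (c + 1) / 2) := by
      intro y c; simp [natVal]; omega
    have e1 : ∀ y c, (natVal (l + 1) (true :: y) < c) = (natVal l y < c / 2) := by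
      intro y c; simp [natVal]; omega
    simp only [e0, e1, List.drop_succ_cons]
    rw [h0, h1]
    have ha : (a + 1) / 2 + a / 2 = a := by omega
    have hc : ((d + 1) / 2 - (a + 1) / 2) + (d / 2 - a / 2) = d - a := by omega
    rw [← hc]
    -- The fifth occurrence of `a` is the factor on the right-hand side.
    nth_rewrite 5 [← ha]
    ring

/-! ### Counting guesses -/

/-- The truth values guessed by the digits `y`, for numerators and denominators `(a, d)`. -/
def guess : List (ℕ × ℕ) → List Bool → List Bool
  | [], _ => []
  | x :: r, y => decide (natVal x.2.bits.length y < x.1) :: guess r (y.drop x.2.bits.length)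

/-- The digits `y` represent numbers below the denominators. -/
def isValid : List (ℕ × ℕ) → List Bool → Bool
  | [], _ => true
  | x :: r, y => decide (natVal x.2.bits.length y < x.2) && isValid r (y.drop x.2.bits.length)

/-- The number of digits to be read. -/
def digitCount : List (ℕ × ℕ) → ℕ
  | [] => 0
  | x :: r => x.2.bits.length + digitCount r

/-- The number of guesses with property `G`. -/
def weight : List (ℕ × ℕ) → (List Bool → Bool) → ℕ
  | [], G => (G []).toNat
  | x :: r, G => x.1 * weight r (fun w => G (true :: w)) +
      (x.2 - x.1) * weight r (fun w => G (false :: w))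

/-- Applies `countWords_digits` block by block; the last `q` digits are free, hence the power of
two. -/
theorem countWords_guess (ds : List (ℕ × ℕ)) (hds : ∀ x ∈ ds, x.1 ≤ x.2) (q : ℕ)
    (G : List Bool → Bool) :
    countWords (digitCount ds + q) (fun y => isValid ds y && G (guess ds y)) =
      2 ^ q * weight ds G := by
  induction ds generalizing G with
  | nil => simp [isValid, guess, weight, digitCount, countWords_const]
  | cons x r ih =>
    have h := countWords_digits x.2.bits.length (digitCount r + q) x.1 x.2 (hds x (by simp))
      (lt_two_pow_length_bits _).le fun b y => isValid r y && G (b :: guess r y)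
    have ih' := ih fun z hz => hds z (by simp [hz])
    rw [ih' fun w => G (true :: w), ih' fun w => G (false :: w)] at h
    rw [digitCount, add_assoc, weight]
    simp only [isValid, guess, Bool.and_assoc]
    rw [h]
    ring

/-! ### The verifier on codes -/

theorem decodeWord_encodeTuple_cons (u : List Bool) (us : List (List Bool)) :
    decodeWord (encodeTuple (u :: us)) = (u, encodeTuple us) := by
  rw [encodeTuple, List.flatMap_cons, decodeWord_encodeWord]
  rfl

theorem encodeTuple_cons_ne_nil (u : List Bool) (us : List (List Bool)) :
    encodeTuple (u :: us) ≠ [] := by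
  simp [encodeTuple, encodeWord]

theorem readAll_encodeTuple {α : Type} (ev : List α) (e : α → List Bool) (c : α → ℕ × ℕ)
    (hc : ∀ x ∈ ev, (c x).1 ≤ (c x).2) (y bv rej : List Bool) :
    (readAll (encodeTuple (ev.flatMap fun x => [e x, (c x).1.bits, (c x).2.bits])) y bv rej).2.1 =
      (guess (ev.map c) y).reverse ++ bv ∧
    ((readAll (encodeTuple (ev.flatMap fun x => [e x, (c x).1.bits, (c x).2.bits])) y bv
      rej).2.2 = [] ↔ rej = [] ∧ isValid (ev.map c) y = true) := by
  induction ev generalizing y bv rej with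
  | nil =>
    rw [readAll, dif_pos (by rfl)]
    simp [guess, isValid]
  | cons x r ih =>
    have hx := hc x (by simp)
    have hlt := lt_two_pow_length_bits (c x).2
    rw [List.flatMap_cons]
    simp only [List.cons_append, List.nil_append]
    rw [readAll, dif_neg (encodeTuple_cons_ne_nil _ _)]
    simp only [numWord, denWord, restWord, decodeWord_encodeTuple_cons, ltWord_eq]
    -- Numerator and denominator are both below 2 to the number of digits of the denominator, so
    -- truncation to that many digits loses nothing.
    rw [natVal_bits _ _ hlt, natVal_bits _ _ (hx.trans_lt hlt)]
    obtain ⟨h1, h2⟩ := ih (fun z hz => hc z (by simp [hz])) (y.drop (c x).2.bits.length)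
      (decide (natVal (c x).2.bits.length y < (c x).1) :: bv)
      (if decide (natVal (c x).2.bits.length y < (c x).2) = true then rej else true :: rej)
    rw [h1, h2]
    refine ⟨by simp [guess], ?_⟩
    by_cases h : natVal (c x).2.bits.length y < (c x).2 <;> simp [isValid, h]

theorem excessStack_eq_append (useP : Bool) (P T l : List Bool) :
    excessStack useP P T l = excessStack useP P T [] ++ l := by
  induction P generalizing T l with
  | nil => rfl
  | cons p P ih =>
    rw [excessStack, ih, excessStack, ih _ (ite _ _ _)]
    split_ifs <;> simp

theorem excessStack_ofFn_eq_nil (useP : Bool) (n : ℕ) (p t : Fin n → Bool) :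
    excessStack useP (List.ofFn p) (List.ofFn t) [] = [] ↔
      (useP = true → ∀ i, t i = true → p i = true) := by
  induction n with
  | zero => simp [excessStack]
  | succ n ih =>
    rw [List.ofFn_succ, List.ofFn_succ, excessStack, excessStack_eq_append,
      List.append_eq_nil_iff, List.tail_cons, ih, Fin.forall_fin_succ]
    cases useP <;> cases t 0 <;> cases p 0 <;> simp

/-- The property of a guess which the verifier tests. -/
def goodGuess (useP : Bool) (F : List Bool → List Bool) (J : List Bool → Bool)
    (fr sj sf P bv : List Bool) : Bool :=
  J (encodeTuple [sj, fr, F (encodeTuple [sf, fr, bv])]) &&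
    (excessStack useP P (F (encodeTuple [sf, fr, bv])) []).isEmpty

/-- All marks share one stack, which is empty exactly if the digits are valid and the subset test
adds no mark. Acceptance thus splits into the form counted by `countWords_guess`. -/
theorem accept_eq (useP : Bool) (F : List Bool → List Bool) (J : List Bool → Bool) (n : ℕ)
    (ev : List (Finset (Fin n) × ℚ))
    (hev : ∀ x ∈ ev, x.2.num.toNat ≤ x.2.den) (sj sf P y : List Bool) :
    accept useP F J (encodeTuple [encodeTuple [encodeEvidenceFrame n ev, sj, sf, P], y]) =
      (isValid (ev.map fun x => (x.2.num.toNat, x.2.den)) y &&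
        goodGuess useP F J (encodeEvidenceFrame n ev) sj sf P
          (guess (ev.map fun x => (x.2.num.toNat, x.2.den)) y)) := by
  obtain ⟨h1, h2⟩ := readAll_encodeTuple ev (fun x => encodeStates x.1)
    (fun x => (x.2.num.toNat, x.2.den)) hev y [] []
  have hf : ∀ y, readFrame (encodeEvidenceFrame n ev) y = readAll (encodeTuple
      (ev.flatMap fun x => [encodeStates x.1, Nat.bits x.2.num.toNat, Nat.bits x.2.den]))
      y [] [] := by
    intro y
    rw [readFrame, encodeEvidenceFrame, decodeWord_encodeTuple_cons]
  rw [← hf] at h1 h2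
  rw [List.append_nil] at h1
  have h3 : guess (ev.map fun x => (x.2.num.toNat, x.2.den)) y =
      (readFrame (encodeEvidenceFrame n ev) y).2.1.reverse := by
    rw [h1, List.reverse_reverse]
  simp only [accept, guessedSet, digitsOf, frameOf, specJOf, specFOf, propOf,
    decodeWord_encodeTuple_cons, goodGuess]
  rw [h3, excessStack_eq_append]
  rw [Bool.eq_iff_iff]
  simp only [Bool.and_eq_true, List.isEmpty_iff, Option.isNone_iff_eq_none, List.head?_eq_none_iff,
    List.append_eq_nil_iff, h2]
  tauto

/-! ### Weights and degrees of belief -/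

theorem cast_num_toNat {p : ℚ} (hp : 0 ≤ p) : (p.num.toNat : ℚ) = p.den * p := by
  have h : ((p.num.toNat : ℤ) : ℚ) = p.num := by rw [Int.toNat_of_nonneg (Rat.num_nonneg.2 hp)]
  rw [mul_comm, Rat.mul_den_eq_num, ← h]
  rfl

theorem num_toNat_le_den {p : ℚ} (hp : 0 ≤ p) (hp1 : p ≤ 1) : p.num.toNat ≤ p.den := by
  have : (p.num.toNat : ℚ) ≤ p.den := by
    rw [cast_num_toNat hp]
    exact mul_le_of_le_one_right (Nat.cast_nonneg _) hp1
  exact_mod_cast this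

section Weight

variable {α : Type} [DecidableEq α]

theorem delta_insert_of_mem {EQ : Finset (Finset α × ℚ)} {x : Finset α × ℚ}
    (hx : x.1 ∉ basicEvidence EQ) (B : Finset (Finset α)) :
    delta (insert x EQ) (insert x.1 B) = x.2 * delta EQ B := by
  have hx' : x ∉ EQ := fun h => hx (Finset.mem_image_of_mem _ h)
  have hne : ∀ z ∈ EQ, z.1 ≠ x.1 := fun z hz h => hx (h ▸ Finset.mem_image_of_mem _ hz)
  rw [delta, delta, Finset.filter_insert, if_pos (by simp), Finset.filter_insert,
    if_neg (by simp), Finset.prod_insert (by simp [hx']), mul_assoc]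
  have e1 : (EQ.filter fun z => z.1 ∈ insert x.1 B) = EQ.filter fun z => z.1 ∈ B :=
    Finset.filter_congr fun z hz => by simp [hne z hz]
  have e2 : (EQ.filter fun z => z.1 ∉ insert x.1 B) = EQ.filter fun z => z.1 ∉ B :=
    Finset.filter_congr fun z hz => by simp [hne z hz]
  rw [e1, e2]

theorem delta_insert_of_notMem {EQ : Finset (Finset α × ℚ)} {x : Finset α × ℚ}
    (hx : x.1 ∉ basicEvidence EQ) {B : Finset (Finset α)} (hB : x.1 ∉ B) :
    delta (insert x EQ) B = (1 - x.2) * delta EQ B := by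
  have hx' : x ∉ EQ := fun h => hx (Finset.mem_image_of_mem _ h)
  rw [delta, delta, Finset.filter_insert, if_neg hB, Finset.filter_insert,
    if_pos hB, Finset.prod_insert (by simp [hx'])]
  ring

/-- The subsets of the evidence split according to whether they contain the first piece. This
contributes p or 1 - p to `delta`, and dp or d - dp to `weight`, where d is the denominator of p.
Distinctness of the pieces keeps the remaining factors unaffected. -/
theorem weight_eq {n : ℕ} (ev : List (Finset (Fin n) × ℚ)) (hnd : (ev.map Prod.fst).Nodup)
    (h01 : ∀ x ∈ ev, 0 < x.2 ∧ x.2 < 1) (G : List Bool → Bool) :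
    (weight (ev.map fun x => (x.2.num.toNat, x.2.den)) G : ℚ) =
      (ev.map fun x => (x.2.den : ℚ)).prod *
        ∑ B ∈ (basicEvidence ev.toFinset).powerset with G (encodeEvidenceSet ev B) = true,
          delta ev.toFinset B := by
  induction ev generalizing G with
  | nil =>
    cases h : G [] <;> simp [weight, basicEvidence, delta, encodeEvidenceSet, h]
  | cons x r ih =>
    rw [List.map_cons, List.nodup_cons] at hnd
    have hx : x.1 ∉ basicEvidence r.toFinset := by
      intro h
      obtain ⟨z, hz, hzx⟩ := Finset.mem_image.1 h
      exact hnd.1 (List.mem_map.2 ⟨z, List.mem_toFinset.1 hz, hzx⟩)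
    obtain ⟨hx0, hx1⟩ := h01 x (by simp)
    have ih' := ih hnd.2 fun z hz => h01 z (by simp [hz])
    have hb : basicEvidence (x :: r).toFinset = insert x.1 (basicEvidence r.toFinset) := by
      simp [basicEvidence]
    rw [List.map_cons, weight, List.map_cons, List.prod_cons, hb, Finset.sum_filter,
      Finset.sum_powerset_insert hx, List.toFinset_cons]
    have e0 : ∀ B ∈ (basicEvidence r.toFinset).powerset, x.1 ∉ B := fun B hB h =>
      hx (Finset.mem_powerset.1 hB h)
    have e1 : ∀ B ∈ (basicEvidence r.toFinset).powerset,
        encodeEvidenceSet (x :: r) B = false :: encodeEvidenceSet r B := by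
      intro B hB
      simp [encodeEvidenceSet, e0 B hB]
    have e2 : ∀ B ∈ (basicEvidence r.toFinset).powerset,
        encodeEvidenceSet (x :: r) (insert x.1 B) = true :: encodeEvidenceSet r B := by
      intro B hB
      simp only [encodeEvidenceSet, List.map_cons, Finset.mem_insert_self, decide_true,
        List.cons.injEq, true_and]
      refine List.map_congr_left fun z hz => ?_
      have : z.1 ≠ x.1 := fun h => hnd.1 (List.mem_map.2 ⟨z, hz, h⟩)
      simp [this]
    have s0 : (∑ B ∈ (basicEvidence r.toFinset).powerset,
        if G (encodeEvidenceSet (x :: r) B) = true then delta (insert x r.toFinset) B else 0) =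
        (1 - x.2) * ∑ B ∈ (basicEvidence r.toFinset).powerset with
          G (false :: encodeEvidenceSet r B) = true, delta r.toFinset B := by
      rw [Finset.sum_filter, Finset.mul_sum]
      refine Finset.sum_congr rfl fun B hB => ?_
      rw [e1 B hB, delta_insert_of_notMem hx (e0 B hB), mul_ite, mul_zero]
    have s1 : (∑ B ∈ (basicEvidence r.toFinset).powerset,
        if G (encodeEvidenceSet (x :: r) (insert x.1 B)) = true then
          delta (insert x r.toFinset) (insert x.1 B) else 0) =
        x.2 * ∑ B ∈ (basicEvidence r.toFinset).powerset with
          G (true :: encodeEvidenceSet r B) = true, delta r.toFinset B := by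
      rw [Finset.sum_filter, Finset.mul_sum]
      refine Finset.sum_congr rfl fun B hB => ?_
      rw [e2 B hB, delta_insert_of_mem hx, mul_ite, mul_zero]
    rw [s0, s1, Nat.cast_add, Nat.cast_mul, Nat.cast_mul,
      Nat.cast_sub (num_toNat_le_den hx0.le hx1.le), ih', ih', cast_num_toNat hx0.le]
    ring

end Weight

/-! ### Belief as a quotient of sums over sets of evidence -/

section Belief

variable {α : Type} [DecidableEq α]

/-- Each `B` is allocated to exactly one set `f B`, so the sum is taken fibrewise. Elements of a
frame are open, which disposes of the case distinction in `deltaTop`. -/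
theorem sum_deltaTop {EQ : Finset (Finset α × ℚ)} {J : Finset (Finset α)}
    (hJ : IsFrameOfJustification (basicEvidence EQ) J) (f : Finset (Finset α) → Finset α)
    {X : Finset (Finset α)} (hX : X ⊆ J) :
    ∑ T ∈ X, deltaTop EQ f T =
      ∑ B ∈ (basicEvidence EQ).powerset with f B ∈ X, delta EQ B := by
  have h : ∀ T ∈ X, deltaTop EQ f T =
      ∑ B ∈ ((basicEvidence EQ).powerset.filter fun B => f B ∈ X) with f B = T, delta EQ B := by
    intro T hT
    rw [deltaTop, if_pos (hJ T (hX hT)), Finset.filter_filter]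
    refine Finset.sum_congr (Finset.filter_congr fun B _ => ?_) fun _ _ => rfl
    exact ⟨fun h => ⟨h ▸ hT, h⟩, fun h => h.2⟩
  rw [Finset.sum_congr rfl h]
  exact Finset.sum_fiberwise_of_maps_to (fun B hB => (Finset.mem_filter.1 hB).2) _

theorem Bel_eq [Fintype α] {EQ : Finset (Finset α × ℚ)} {J : Finset (Finset α)}
    (hJ : IsFrameOfJustification (basicEvidence EQ) J) (f : Finset (Finset α) → Finset α)
    (P : Finset α) :
    Bel EQ J f P = (∑ B ∈ (basicEvidence EQ).powerset with f B ∈ J ∧ f B ⊆ P, delta EQ B) /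
      ∑ B ∈ (basicEvidence EQ).powerset with f B ∈ J, delta EQ B := by
  have h : Bel EQ J f P = (∑ A ∈ J.filter (· ⊆ P), deltaTop EQ f A) / normalization EQ J f := by
    simp only [Bel, deltaJ]
    rw [Finset.sum_ite, Finset.sum_const_zero, add_zero, Finset.sum_div]
    refine Finset.sum_congr ?_ fun _ _ => rfl
    ext A
    simp [and_comm]
  rw [h, normalization, sum_deltaTop hJ f (Finset.filter_subset _ _), sum_deltaTop hJ f subset_rfl]
  simp only [Finset.mem_filter]

end Belief

/-! ### Lengths of codes -/

theorem sum_length_le_length_encodeTuple (us : List (List Bool)) :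
    (us.map List.length).sum ≤ (encodeTuple us).length := by
  induction us with
  | nil => simp [encodeTuple]
  | cons u us ih =>
    have : encodeTuple (u :: us) = encodeWord u ++ encodeTuple us := by
      simp [encodeTuple, List.flatMap_cons]
    rw [this, List.map_cons, List.sum_cons, List.length_append, length_encodeWord]
    omega

/-- The denominators are written out in the input, so certificates as long as the input contain
enough digits. -/
theorem digitCount_le {n : ℕ} (ev : List (Finset (Fin n) × ℚ)) :
    digitCount (ev.map fun x => (x.2.num.toNat, x.2.den)) ≤ (encodeEvidenceFrame n ev).length := by
  refine le_trans ?_ (sum_length_le_length_encodeTuple _)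
  rw [List.map_cons, List.sum_cons]
  refine le_trans ?_ (Nat.le_add_left _ _)
  induction ev with
  | nil => simp [digitCount]
  | cons x r ih =>
    rw [List.map_cons, digitCount, List.flatMap_cons, List.map_append, List.sum_append]
    refine Nat.add_le_add ?_ ih
    simp only [List.map_cons, List.map_nil, List.sum_cons, List.sum_nil]
    omega

/-! ### The two counting functions on instances -/

section Instance

variable {evalJ : List Bool → Bool} {evalF : List Bool → List Bool}

theorem goodGuess_encodeEvidenceSet (I : Instance evalJ evalF) (useP : Bool)
    {B : Finset (Finset (Fin I.n))} (hB : B ⊆ basicEvidence I.evidence.toFinset) :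
    goodGuess useP evalF evalJ (encodeEvidenceFrame I.n I.evidence) I.specJ I.specF
      (encodeStates I.P) (encodeEvidenceSet I.evidence B) = true ↔
      I.f B ∈ I.J ∧ (useP = true → I.f B ⊆ I.P) := by
  rw [goodGuess, I.specF_spec B hB, Bool.and_eq_true, I.specJ_spec, List.isEmpty_iff,
    encodeStates, encodeStates, excessStack_ofFn_eq_nil]
  simp [Finset.subset_iff]

/-- The number of accepted certificates of length `|x|`. -/
def countAccepted (useP : Bool) (F : List Bool → List Bool) (J : List Bool → Bool)
    (x : List Bool) : ℕ :=
  (Finset.univ.filter fun y : List.Vector Bool ((Polynomial.X : Polynomial ℕ).eval x.length) =>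
    accept useP F J (encodeTuple [x, y.toList]) = true).card

theorem inSharpP_countAccepted (useP : Bool) (hJ : PolyTimeDecidable evalJ)
    (hF : PolyTimeComputable evalF) : InSharpP (countAccepted useP evalF evalJ) :=
  ⟨Polynomial.X, accept useP evalF evalJ, polyTimeDecidable_accept useP hF hJ, fun _ => rfl⟩

/-- It matters that `c` is chosen before `useP`: the same factor occurs in numerator and denominator
and cancels. -/
theorem exists_countAccepted_eq (I : Instance evalJ evalF) : ∃ c : ℚ, c ≠ 0 ∧ ∀ useP : Bool,
    (countAccepted useP evalF evalJ I.encode : ℚ) =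
      c * ∑ B ∈ (basicEvidence I.evidence.toFinset).powerset with
        I.f B ∈ I.J ∧ (useP = true → I.f B ⊆ I.P), delta I.evidence.toFinset B := by
  let ds : List (ℕ × ℕ) := I.evidence.map fun x => (x.2.num.toNat, x.2.den)
  have h01 : ∀ x ∈ I.evidence, 0 < x.2 ∧ x.2 < 1 := fun x hx =>
    ⟨I.isEvidence.degree_pos x (List.mem_toFinset.2 hx),
      I.isEvidence.degree_lt_one x (List.mem_toFinset.2 hx)⟩
  have hle : ∀ x ∈ I.evidence, x.2.num.toNat ≤ x.2.den := fun x hx =>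
    num_toNat_le_den (h01 x hx).1.le (h01 x hx).2.le
  have hds : ∀ x ∈ ds, x.1 ≤ x.2 := by
    intro x hx
    obtain ⟨z, hz, rfl⟩ := List.mem_map.1 hx
    exact hle z hz
  have hnd : (I.evidence.map Prod.fst).Nodup :=
    I.evidence_nodup.map_on fun x hx y hy h => I.isEvidence.distinct x (List.mem_toFinset.2 hx)
      y (List.mem_toFinset.2 hy) h
  have hlen : digitCount ds ≤ I.encode.length := by
    refine (digitCount_le I.evidence).trans (le_trans ?_ (sum_length_le_length_encodeTuple _))
    rw [List.map_cons, List.sum_cons]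
    exact Nat.le_add_right _ _
  -- `q` is the number of digits of a certificate that are never used.
  obtain ⟨q, hq⟩ := Nat.exists_eq_add_of_le hlen
  refine ⟨2 ^ q * (I.evidence.map fun x => (x.2.den : ℚ)).prod, ?_, fun useP => ?_⟩
  · refine mul_ne_zero (by positivity) (List.prod_ne_zero ?_)
    intro h
    obtain ⟨z, _, hz⟩ := List.mem_map.1 h
    exact z.2.den_nz (by exact_mod_cast hz)
  · rw [countAccepted,
      card_filter_eq_countWords _ fun y => accept useP evalF evalJ (encodeTuple [I.encode, y])]
    have : ∀ y, accept useP evalF evalJ (encodeTuple [I.encode, y]) = _ := fun y =>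
      accept_eq useP evalF evalJ I.n I.evidence hle I.specJ I.specF (encodeStates I.P) y
    simp only [this]
    rw [Polynomial.eval_X, hq, countWords_guess ds hds, Nat.cast_mul, weight_eq _ hnd h01,
      Nat.cast_pow, Nat.cast_ofNat, mul_assoc]
    congr 2
    refine Finset.sum_congr (Finset.filter_congr fun B hB => ?_) fun _ _ => rfl
    exact goodGuess_encodeEvidenceSet I useP (Finset.mem_powerset.1 hB)

end Instance

end StackProgram

end

theorem mainTheorem5 (evalJ : List Bool → Bool) (evalF : List Bool → List Bool)
    (hJ : MultiLayerBelief.PolyTimeDecidable evalJ)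
    (hF : MultiLayerBelief.PolyTimeComputable evalF) :
    MultiLayerBelief.FractionInSharpP
      (MultiLayerBelief.Instance.encode (evalJ := evalJ) (evalF := evalF))
      MultiLayerBelief.Instance.degreeOfBelief := by
  refine ⟨StackProgram.countAccepted true evalF evalJ, StackProgram.countAccepted false evalF evalJ,
    StackProgram.inSharpP_countAccepted true hJ hF, StackProgram.inSharpP_countAccepted false hJ hF,
    fun I => ?_⟩
  obtain ⟨c, hc, h⟩ := StackProgram.exists_countAccepted_eq I
  have hn := I.normalization_ne_zero
  -- The normalization is the sum counted with `useP = false`, so its being nonzero gives a nonzero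
  -- denominator.
  rw [MultiLayerBelief.normalization, StackProgram.sum_deltaTop I.isFrame I.f subset_rfl] at hn
  have h0 := h false
  have h1 := h true
  simp only [Bool.false_eq_true, false_implies, and_true, forall_const] at h0 h1
  constructor
  · intro h2
    rw [h2, Nat.cast_zero] at h0
    exact mul_ne_zero hc hn h0.symm
  · rw [h0, h1, MultiLayerBelief.Instance.degreeOfBelief, StackProgram.Bel_eq I.isFrame,
      mul_div_mul_left _ _ hc]
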